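/- Let $d\ge 1$ be an integer, $\alpha>1/2$, and let $\gamma=(\gamma_{\mathfrak u})_{\mathfrak u\subseteq\{1,\dots,d\}}$ be weights with $0<\gamma_{\mathfrak v}\le\gamma_{\mathfrak w}\le 1$ whenever $\mathfrak w\subseteq\mathfrak v$. For $h\in\mathbb Z^d$ put $\operatorname{supp}(h)=\{j:h_j\ne0\}$ and $$r_{2\alpha,\gamma}(h)=\gamma_{\operatorname{supp}(h)}^{-1}\prod_{j\in\operatorname{supp}(h)}|h_j|^{2\alpha}.$$ The weighted Korobov space $\mathcal H_{d,\alpha,\gamma}$ consists of the functions $f:\mathbb R^d\to\mathbb C$ that are one-periodic in each variable, are represented pointwise by their Fourier series (equivalently, are continuous), and satisfy $\|f\|_{d,\alpha,\gamma}^2:=\sum_{h\in\mathbb Z^d}|\widehat f(h)|^2\,r_{2\alpha,\gamma}(h)<\infty$. For $L\ge 0$ let $$\mathcal A_d(L)=\Big\{h\in\mathbb Z^d:\prod_{j\in\operatorname{supp}(h)}|h_j|<L\Big\},\qquad \mathcal A_{d,\alpha,\gamma}(L)=\{h\in\mathbb Z^d:r_{2\alpha,\gamma}(h)<L^{2\alpha}\}.$$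 **Algorithm.** Let $N$ be an odd prime and $R$ an odd natural number. Draw independently, for $r=1,\dots,R$, a vector $z_r$ uniformly from $\{1,\dots,N-1\}^d$ and a shift $\Delta_r$ uniformly from $[0,1)^d$, and put $$\widehat f_r(h)=\frac1N\sum_{k=0}^{N-1}f\big(\{k z_r/N+\Delta_r\}\big)\,e^{-2\pi \mathrm i\, h\cdot(k z_r/N+\Delta_r)}\qquad(h\in\mathbb Z^d),$$ where $\{\cdot\}$ is the componentwise fractional part. Order $\mathcal A_d(N/2)$ by descending values of $\operatorname{median}_{r}|\widehat f_r(h)|^2$, with ties broken arbitrarily, and let $K_N$ be the set of the first $N$ elements. The output is $$A^{\mathrm{rand}}(f)(x)=\sum_{h\in K_N}\Big(\operatorname{median}_{r}\widehat f_r(h)\Big)e^{2\pi \mathrm i\, h\cdot x},$$ where the median of complex numbers is taken separately for real and imaginary parts. The algorithm uses neither $\alpha$ nor $\gamma$. **Theorem.** Let $f\in\mathcal H_{d,\alpha,\gamma}$, let $N$ be an odd prime, $R$ an odd natural number and $\varepsilon\in(0,1)$ with $\varepsilon_1+\varepsilon_2\le\varepsilon$, where $$\varepsilon_1=N\,2^{-R/2},\qquad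 \varepsilon_2=\frac{|\mathcal A_d(N/2)|}{2}\Big(\frac12\Big)^{R/2}+\frac N2\Big(\frac34\Big)^{R/2}.$$ Then, with probability at least $1-\varepsilon$ (simultaneously for all ways of breaking ties in the choice of $K_N$), $$\|f-A^{\mathrm{rand}}(f)\|_{L_2([0,1)^d)}^2\le\frac{32\,\|f\|_{d,\alpha,\gamma}^2\,(2N-1)}{N_*^{2\alpha}(N-1)}\left(\frac{991N-255}{120(2N-1)}+\max\Big(960,\sqrt{240\,N_*^{4\alpha}\,\bar r_{\mathrm{sum}}}\Big)\right),$$ where $N_*=\sup\{L\ge0:|\mathcal A_{d,\alpha,\gamma}(L)|\le (N-1)/16\}$ and $$\bar r_{\mathrm{sum}}=16\left(\frac{4\alpha}{N-1}\int_{N_*}^\infty\frac{|\mathcal A_{d,\alpha,\gamma}(L)|}{L^{4\alpha+1}}\,\mathrm dL+\frac1{N^{4\alpha}}\sum_{\emptyset\ne\mathfrak u\subseteq\{1,\dots,d\}}\gamma_{\mathfrak u}^2\big(2^{1+4\alpha}\zeta(4\alpha)\big)^{|\mathfrak u|}\right),$$ with $\zeta$ the Riemann zeta function. -/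

import Mathlib

open MeasureTheory ProbabilityTheory UnitAddTorus

noncomputable section

namespace MedianLattice

/-! ### Weighted Korobov space -/

/-- The set `supp h = {j | h j ≠ 0}`. -/
def supp {d : ℕ} (h : Fin d → ℤ) : Finset (Fin d) :=
  Finset.univ.filter fun j => h j ≠ 0

/-- The Fourier weight `r_{2α,γ}(h) = γ_{supp h}⁻¹ ∏_{j ∈ supp h} |h_j|^{2α}`. -/
def fourierWeight {d : ℕ} (α : ℝ) (γ : Finset (Fin d) → ℝ) (h : Fin d → ℤ) : ℝ :=
  (γ (supp h))⁻¹ * ∏ j ∈ supp h, |(h j : ℝ)| ^ (2 * α)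

/-- Membership in the weighted Korobov space. A function that is one-periodic in each variable is
a function on the torus `(ℝ / ℤ)^d`. For `α > 1/2` and weights in `(0, 1]` a finite norm makes the
Fourier coefficients absolutely summable, so that continuity just says that the function is
represented pointwise by its Fourier series. -/
structure MemKorobov {d : ℕ} (α : ℝ) (γ : Finset (Fin d) → ℝ)
    (f : UnitAddTorus (Fin d) → ℂ) : Prop where
  continuous : Continuous f
  summable : Summable fun h : Fin d → ℤ => ‖mFourierCoeff f h‖ ^ 2 * fourierWeight α γ h

/-- The squared Korobov norm `‖f‖²_{d,α,γ}`. -/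
def korobovNormSq {d : ℕ} (α : ℝ) (γ : Finset (Fin d) → ℝ)
    (f : UnitAddTorus (Fin d) → ℂ) : ℝ :=
  ∑' h : Fin d → ℤ, ‖mFourierCoeff f h‖ ^ 2 * fourierWeight α γ h

/-- The weights are positive, at most one, and downward-closed. -/
structure IsDownwardClosedWeights {d : ℕ} (γ : Finset (Fin d) → ℝ) : Prop where
  pos : ∀ u, 0 < γ u
  le_one : ∀ u, γ u ≤ 1
  anti : ∀ w v : Finset (Fin d), w ⊆ v → γ v ≤ γ w

/-! ### Index sets -/

/-- The unweighted hyperbolic cross `A_d(L)`. -/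
def hyperbolicCross (d : ℕ) (L : ℝ) : Set (Fin d → ℤ) :=
  {h | ∏ j ∈ supp h, |(h j : ℝ)| < L}

/-- The weighted hyperbolic cross `A_{d,α,γ}(L)`. -/
def weightedCross {d : ℕ} (α : ℝ) (γ : Finset (Fin d) → ℝ) (L : ℝ) : Set (Fin d → ℤ) :=
  {h | fourierWeight α γ h < L ^ (2 * α)}

/-- `N_* = sup {L ≥ 0 : |A_{d,α,γ}(L)| ≤ (N - 1) / 16}`. -/
def nStar {d : ℕ} (α : ℝ) (γ : Finset (Fin d) → ℝ) (N : ℕ) : ℝ :=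
  sSup {L : ℝ | 0 ≤ L ∧ ((weightedCross α γ L).ncard : ℝ) ≤ ((N : ℝ) - 1) / 16}

/-- The quantity `r̄_sum`. -/
def rSumBar {d : ℕ} (α : ℝ) (γ : Finset (Fin d) → ℝ) (N : ℕ) : ℝ :=
  16 * (4 * α / ((N : ℝ) - 1) *
      (∫ L in Set.Ioi (nStar α γ N), ((weightedCross α γ L).ncard : ℝ) / L ^ (4 * α + 1)) +
    1 / (N : ℝ) ^ (4 * α) *
      ∑ u ∈ Finset.univ.filter fun u : Finset (Fin d) => u.Nonempty,
        γ u ^ 2 * ((2 : ℝ) ^ (1 + 4 * α) * (riemannZeta ((4 * α : ℝ) : ℂ)).re) ^ u.card)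

/-! ### The universal median lattice algorithm

Nothing in this part depends on `α` or `γ`. -/

/-- The median of `R` real numbers, for odd `R`: the middle one in increasing order. -/
def realMedian {R : ℕ} [NeZero R] (v : Fin R → ℝ) : ℝ :=
  v (Tuple.sort v ⟨R / 2, Nat.div_lt_self (NeZero.pos R) one_lt_two⟩)

/-- The median of complex numbers, taken separately in the real and imaginary parts. -/
def complexMedian {R : ℕ} [NeZero R] (v : Fin R → ℂ) : ℂ :=
  ⟨realMedian fun r => (v r).re, realMedian fun r => (v r).im⟩

/-- The normalised Haar measure on `(ℝ / ℤ)^d`, i.e. the uniform distribution on `[0,1)^d`. -/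
def torusMeasure (d : ℕ) : Measure (UnitAddTorus (Fin d)) :=
  Measure.pi fun _ => AddCircle.haarAddCircle

/-- The generating vectors `{1, …, N - 1}^d`. -/
def generatingVectors (N d : ℕ) : Set (Fin d → ℕ) :=
  Set.pi Set.univ fun _ => Set.Icc 1 (N - 1)

/-- A draw of the `R` pairs (generating vector, shift). -/
abbrev Sample (d R : ℕ) : Type := Fin R → (Fin d → ℕ) × UnitAddTorus (Fin d)

/-- The law of the random draw: all `z_r` and `Δ_r` are independent and uniform on
`{1, …, N - 1}^d` and on `[0,1)^d`, respectively. -/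
def sampleLaw (d N R : ℕ) : Measure (Sample d R) :=
  Measure.pi fun _ => (uniformOn (generatingVectors N d)).prod (torusMeasure d)

/-- The `k`-th point of the lattice generated by `z`, shifted by `Δ`, modulo one. -/
def latticePoint {d : ℕ} (N : ℕ) (z : Fin d → ℕ) (Δ : UnitAddTorus (Fin d)) (k : ℕ) :
    UnitAddTorus (Fin d) :=
  fun j => (((k : ℝ) * (z j : ℝ) / (N : ℝ) : ℝ) : UnitAddCircle) + Δ j

/-- The shifted lattice rule for the `h`-th Fourier coefficient of `f`; here
`mFourier (-h) x = exp (-2πi h ⬝ x)`. -/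
def latticeCoeff {d : ℕ} (f : UnitAddTorus (Fin d) → ℂ) (N : ℕ) (z : Fin d → ℕ)
    (Δ : UnitAddTorus (Fin d)) (h : Fin d → ℤ) : ℂ :=
  1 / (N : ℂ) *
    ∑ k ∈ Finset.range N, f (latticePoint N z Δ k) * mFourier (-h) (latticePoint N z Δ k)

/-- The median over `r` of the squared moduli of the estimated `h`-th coefficients. -/
def medianSq {d R : ℕ} [NeZero R] (f : UnitAddTorus (Fin d) → ℂ) (N : ℕ) (ω : Sample d R)
    (h : Fin d → ℤ) : ℝ :=
  realMedian fun r => ‖latticeCoeff f N (ω r).1 (ω r).2 h‖ ^ 2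

/-- The median estimator of the `h`-th Fourier coefficient. -/
def medianCoeff {d R : ℕ} [NeZero R] (f : UnitAddTorus (Fin d) → ℂ) (N : ℕ) (ω : Sample d R)
    (h : Fin d → ℤ) : ℂ :=
  complexMedian fun r => latticeCoeff f N (ω r).1 (ω r).2 h

/-- `K` consists of the first `N` elements of `A_d(N/2)` in some ordering by descending
`medianSq`; ties may be broken in any way. -/
structure IsSelection {d R : ℕ} [NeZero R] (f : UnitAddTorus (Fin d) → ℂ) (N : ℕ)
    (ω : Sample d R) (K : Finset (Fin d → ℤ)) : Prop where
  subset : ∀ h ∈ K, h ∈ hyperbolicCross d ((N : ℝ) / 2)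
  card : K.card = N
  largest : ∀ h ∈ K, ∀ h' ∈ hyperbolicCross d ((N : ℝ) / 2), h' ∉ K →
    medianSq f N ω h' ≤ medianSq f N ω h

/-- The output of the algorithm for the selected index set `K`. -/
def medianApprox {d R : ℕ} [NeZero R] (f : UnitAddTorus (Fin d) → ℂ) (N : ℕ) (ω : Sample d R)
    (K : Finset (Fin d → ℤ)) (x : UnitAddTorus (Fin d)) : ℂ :=
  ∑ h ∈ K, medianCoeff f N ω h * mFourier h x

/-- The squared `L_2` distance of `f` and `g`. -/
def l2DistSq {d : ℕ} (f g : UnitAddTorus (Fin d) → ℂ) : ℝ :=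
  ∫ x, ‖f x - g x‖ ^ 2 ∂(torusMeasure d)

/-! ### The failure probabilities -/

/-- `ε₁ = N 2^{-R/2}`. -/
def epsOne (N R : ℕ) : ℝ := (N : ℝ) * (2 : ℝ) ^ (-((R : ℝ) / 2))

/-- `ε₂ = |A_d(N/2)| / 2 ⬝ (1/2)^{R/2} + N / 2 ⬝ (3/4)^{R/2}`. -/
def epsTwo (d N R : ℕ) : ℝ :=
  ((hyperbolicCross d ((N : ℝ) / 2)).ncard : ℝ) / 2 * (1 / 2 : ℝ) ^ ((R : ℝ) / 2) +
    (N : ℝ) / 2 * (3 / 4 : ℝ) ^ ((R : ℝ) / 2)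

/-! ### The algorithm is well defined -/

theorem abs_lt_of_mem_hyperbolicCross {d : ℕ} {L : ℝ} {h : Fin d → ℤ}
    (hh : h ∈ hyperbolicCross d L) (j : Fin d) (hj : h j ≠ 0) : |(h j : ℝ)| < L := by
  have h1 : ∀ i ∈ supp h, 1 ≤ |(h i : ℝ)| := by
    intro i hi
    have : h i ≠ 0 := by simpa [supp] using hi
    exact_mod_cast Int.one_le_abs this
  have hmem : j ∈ supp h := by simpa [supp] using hj
  refine lt_of_le_of_lt ?_ hh
  rw [← Finset.mul_prod_erase _ _ hmem]
  refine le_mul_of_one_le_right (abs_nonneg _) ?_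
  refine Finset.prod_induction _ (fun x : ℝ => 1 ≤ x) (fun a b ha hb => ?_) le_rfl
    (fun i hi => h1 i (Finset.mem_of_mem_erase hi))
  exact one_le_mul_of_one_le_of_one_le ha hb

theorem finite_hyperbolicCross (d : ℕ) (L : ℝ) : (hyperbolicCross d L).Finite := by
  refine (Set.finite_Icc (fun _ : Fin d => -⌈|L|⌉) (fun _ => ⌈|L|⌉)).subset fun h hh => ?_
  have key : ∀ j, |h j| ≤ ⌈|L|⌉ := by
    intro j
    by_cases hj : h j = 0
    · rw [hj, abs_zero]; exact Int.ceil_nonneg (abs_nonneg L)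
    · have := (abs_lt_of_mem_hyperbolicCross hh j hj).le.trans
        ((le_abs_self L).trans (Int.le_ceil |L|))
      exact_mod_cast this
  exact ⟨fun j => (abs_le.mp (key j)).1, fun j => (abs_le.mp (key j)).2⟩

theorem le_card_hyperbolicCross {d N : ℕ} (hd : 1 ≤ d) (hN : 3 ≤ N) (hN' : Odd N) :
    N ≤ (finite_hyperbolicCross d ((N : ℝ) / 2)).toFinset.card := by
  obtain ⟨m, rfl⟩ := hN'
  let j₀ : Fin d := ⟨0, hd⟩
  have hinj : Function.Injective fun t : ℤ => (Pi.single j₀ t : Fin d → ℤ) :=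
    Pi.single_injective (M := fun _ : Fin d => ℤ) j₀
  have hc : ((Finset.Icc (-(m : ℤ)) m).image fun t : ℤ => (Pi.single j₀ t : Fin d → ℤ)).card
      = 2 * m + 1 := by
    rw [Finset.card_image_of_injective _ hinj, Int.card_Icc]
    omega
  refine hc.symm.le.trans (Finset.card_le_card fun h hh => ?_)
  obtain ⟨t, ht, rfl⟩ := Finset.mem_image.mp hh
  rw [Finset.mem_Icc] at ht
  rw [Set.Finite.mem_toFinset]
  have hm : (1 : ℝ) ≤ m := by
    have : 1 ≤ m := by omega
    exact_mod_cast this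
  change ∏ j ∈ supp (Pi.single j₀ t : Fin d → ℤ), |((Pi.single j₀ t : Fin d → ℤ) j : ℝ)| < _
  push_cast
  by_cases h0 : t = 0
  · have : supp (Pi.single j₀ t : Fin d → ℤ) = ∅ := by simp [supp, h0]
    rw [this, Finset.prod_empty]
    linarith
  · have : supp (Pi.single j₀ t : Fin d → ℤ) = {j₀} := by
      ext j
      by_cases hj : j = j₀
      · simp [supp, hj, h0]
      · simp [supp, hj]
    rw [this, Finset.prod_singleton, Pi.single_eq_same]
    have h2 : |(t : ℝ)| ≤ m := by
      have := abs_le.mpr ht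
      exact_mod_cast this
    linarith

theorem exists_isSelection {d R N : ℕ} [NeZero R] (hd : 1 ≤ d) (hN : 3 ≤ N) (hN' : Odd N)
    (f : UnitAddTorus (Fin d) → ℂ) (ω : Sample d R) : ∃ K, IsSelection f N ω K := by
  set A := (finite_hyperbolicCross d ((N : ℝ) / 2)).toFinset with hA
  have main : ∀ n ≤ A.card, ∃ K ⊆ A, K.card = n ∧
      ∀ h ∈ K, ∀ h' ∈ A, h' ∉ K → medianSq f N ω h' ≤ medianSq f N ω h := by
    intro n
    induction n with
    | zero => exact fun _ => ⟨∅, by simp⟩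
    | succ n ih =>
      intro hn
      obtain ⟨K, hK, hc, hl⟩ := ih (by omega)
      have hne : (A \ K).Nonempty := by
        rw [← Finset.card_pos, Finset.card_sdiff_of_subset hK]
        omega
      obtain ⟨x, hx, hmax⟩ := Finset.exists_max_image (A \ K) (medianSq f N ω) hne
      rw [Finset.mem_sdiff] at hx
      refine ⟨insert x K, Finset.insert_subset hx.1 hK, ?_, ?_⟩
      · rw [Finset.card_insert_of_notMem hx.2, hc]
      · intro h hh h' hh' hnot
        rw [Finset.mem_insert, not_or] at hnot
        rcases Finset.mem_insert.mp hh with rfl | hh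
        · exact hmax h' (Finset.mem_sdiff.mpr ⟨hh', hnot.2⟩)
        · exact hl h hh h' hh' hnot.2
  obtain ⟨K, hK, hc, hl⟩ := main N (le_card_hyperbolicCross hd hN hN')
  exact ⟨K, fun h hh => by simpa [hA] using hK hh, hc,
    fun h hh h' hh' hn => hl h hh h' (by simpa [hA] using hh') hn⟩

end MedianLattice

end

open MedianLattice

/-!
The proof compares the selection with the weighted cross `S = A_{d,α,γ}(N_*)`. It has at most
`(N - 1) / 16` elements (`ncard_weightedCross_nStar_le`), it lies in `A_d(N/2)` because the weights
are downward closed (`weightedCross_nStar_subset`), and the squared coefficients of `f` outside it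
have sum `B ≤ ‖f‖² / N_*^{2α}` (`tsum_sq_removeModes_mul_le`).

*One draw.* A frequency `k ≠ h` is aliased to `h` when `k - h` lies in the dual lattice, which has
probability at most `1 / (N - 1)` over the generating vector unless `k ≡ h` modulo `N`
(`uniformOn_mem_dualLattice_le`); distinct frequencies in `A_d(N/2)` are incongruent. So with
probability at least `15/16` no element of `S` is aliased to a given `h ∈ A_d(N/2)`, and then the
error of the estimated coefficient comes from the modes outside `S` only. By Parseval's identity in
the shift, the mean square of that part is at most `V_h = B / (N - 1) + T_h`, where `T_h` collects
the squared coefficients at the frequencies congruent to `h`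
(`lintegral_lintegral_sq_latticeCoeff_sub_le`). Markov's inequality gives a squared error of at most
`16 V_h` with probability at least `7/8` (`measure_badDraws_le`).

*All draws.* By a union bound over sets of `(R + 1) / 2` draws, for each `h` a majority of the draws
has this accuracy except with probability `(1/2) (1/2)^{R/2}` (`measure_pi_majority_le`). Summing
over `h ∈ A_d(N/2)` gives the first term of `ε₂`. The medians inherit the accuracy of the majority.

*The error.* Each residue class modulo `N` meets `A_d(N/2)` at most once, so the `T_h` add up to at
most `B`, and the sum of `V_h` over any `N` frequencies of `A_d(N/2)` is at most `c B` with
`c = (2N - 1) / (N - 1)` (`sum_varianceBound_le`), no matter how the random selection `K` depends on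
the draws. This controls the estimated coefficients. A frequency in `S \ K` is matched with one in
`K \ S` whose median is no smaller, so its coefficient is at most the matched coefficient, which is
counted in `B`, plus two estimation errors (`sum_sdiff_selection_le`). Altogether the squared error
is at most `(128 c + 4) B`, which is below `32 c ⬝ 960 ⬝ ‖f‖² / N_*^{2α}`; so the lower bound `960`
of the maximum in the claim is already enough, whatever the value of the square root next to it.
-/

namespace MedianLattice

/-! ### Fourier analysis on the torus -/

instance isProbabilityMeasure_torusMeasure (d : ℕ) : IsProbabilityMeasure (torusMeasure d) := by
  unfold torusMeasure; infer_instance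

instance isAddHaarMeasure_torusMeasure (d : ℕ) : (torusMeasure d).IsAddHaarMeasure := by
  unfold torusMeasure; infer_instance

theorem mFourierCoeff_eq_integral_torusMeasure {d : ℕ} (f : UnitAddTorus (Fin d) → ℂ)
    (n : Fin d → ℤ) :
    mFourierCoeff f n = ∫ t, mFourier (-n) t * f t ∂(torusMeasure d) := rfl

theorem integrable_torusMeasure {d : ℕ} {f : UnitAddTorus (Fin d) → ℂ} (hf : Continuous f) :
    Integrable f (torusMeasure d) :=
  hf.integrable_of_hasCompactSupport (HasCompactSupport.of_compactSpace f)

/-- Parseval's identity for continuous functions. -/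
theorem hasSum_sq_mFourierCoeff_of_continuous {d : ℕ} {f : UnitAddTorus (Fin d) → ℂ}
    (hf : Continuous f) :
    HasSum (fun k => ‖mFourierCoeff f k‖ ^ 2) (∫ x, ‖f x‖ ^ 2 ∂(torusMeasure d)) := by
  set F : Lp ℂ 2 (torusMeasure d) := ContinuousMap.toLp 2 (torusMeasure d) ℂ ⟨f, hf⟩ with hF
  have hae : F =ᵐ[torusMeasure d] f := ContinuousMap.coeFn_toLp _ _
  have key : HasSum (fun k => ‖mFourierCoeff F k‖ ^ 2) (∫ x, ‖F x‖ ^ 2 ∂(torusMeasure d)) :=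
    UnitAddTorus.hasSum_sq_mFourierCoeff F
  have h1 : ∀ n, mFourierCoeff F n = mFourierCoeff f n := fun n =>
    UnitAddTorus.mFourierCoeff_toLp ⟨f, hf⟩ n
  simp only [h1] at key
  have hI : ∫ x, ‖F x‖ ^ 2 ∂(torusMeasure d) = ∫ x, ‖f x‖ ^ 2 ∂(torusMeasure d) := by
    refine integral_congr_ae ?_
    filter_upwards [hae] with x hx
    rw [hx]
  rwa [hI] at key

theorem mFourier_apply_add {d : ℕ} (m : Fin d → ℤ) (x y : UnitAddTorus (Fin d)) :
    mFourier m (x + y) = mFourier m x * mFourier m y := by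
  simp only [mFourier, ContinuousMap.coe_mk, Pi.add_apply, ← Finset.prod_mul_distrib]
  refine Finset.prod_congr rfl fun i _ => ?_
  simp [fourier_apply, smul_add, AddCircle.toCircle_add]

theorem mFourierCoeff_sub {d : ℕ} {f g : UnitAddTorus (Fin d) → ℂ} (hf : Continuous f)
    (hg : Continuous g) (n : Fin d → ℤ) :
    mFourierCoeff (fun x => f x - g x) n = mFourierCoeff f n - mFourierCoeff g n := by
  simp only [mFourierCoeff_eq_integral_torusMeasure, mul_sub]
  exact integral_sub (integrable_torusMeasure (by fun_prop)) (integrable_torusMeasure (by fun_prop))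

theorem mFourierCoeff_mFourier {d : ℕ} (k n : Fin d → ℤ) :
    mFourierCoeff (mFourier k) n = if n = k then 1 else 0 := by
  rw [← orthonormal_iff_ite.mp (orthonormal_mFourier (d := Fin d)) n k, mFourierLp, mFourierLp,
    ContinuousMap.inner_toLp]
  simp only [← mFourier_neg, mul_comm (mFourier k _)]
  rfl

theorem mFourierCoeff_trigPoly {d : ℕ} (S : Finset (Fin d → ℤ)) (c : (Fin d → ℤ) → ℂ)
    (n : Fin d → ℤ) :
    mFourierCoeff (fun x => ∑ k ∈ S, c k * mFourier k x) n = if n ∈ S then c n else 0 := by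
  have h : ∀ k, ∫ t, mFourier (-n) t * (c k * mFourier k t) ∂(torusMeasure d)
      = if n = k then c k else 0 := by
    intro k
    have := mFourierCoeff_mFourier k n
    rw [mFourierCoeff_eq_integral_torusMeasure] at this
    simp_rw [mul_left_comm _ (c k)]
    rw [integral_const_mul, this]
    simp
  simp only [mFourierCoeff_eq_integral_torusMeasure, Finset.mul_sum]
  rw [integral_finsetSum _ fun k _ => integrable_torusMeasure (by fun_prop)]
  simp only [h, Finset.sum_ite_eq]

/-- The Fourier coefficients of a translate. -/
theorem mFourierCoeff_translate {d : ℕ} (f : UnitAddTorus (Fin d) → ℂ) (y : UnitAddTorus (Fin d))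
    (n : Fin d → ℤ) :
    mFourierCoeff (fun t => f (y + t)) n = mFourier n y * mFourierCoeff f n := by
  simp only [mFourierCoeff_eq_integral_torusMeasure]
  rw [← integral_const_mul,
    ← integral_add_left_eq_self (fun t => mFourier n y * (mFourier (-n) t * f t)) y]
  congr 1 with x
  have h : mFourier n y * mFourier (-n) y = 1 := by
    rw [← mFourier_add, add_neg_cancel, mFourier_zero]; rfl
  rw [mFourier_apply_add]
  linear_combination (-(mFourier (-n) x * f (y + x))) * h

/-! ### The shifted lattice rule -/

/-- The dual lattice of the rank-one lattice generated by `z / N`. -/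
def dualLattice {d : ℕ} (N : ℕ) (z : Fin d → ℕ) : Set (Fin d → ℤ) :=
  {m | (N : ℤ) ∣ ∑ j, m j * (z j : ℤ)}

theorem latticePoint_eq_add {d : ℕ} (N : ℕ) (z : Fin d → ℕ) (Δ : UnitAddTorus (Fin d)) (k : ℕ) :
    latticePoint N z Δ k = latticePoint N z 0 k + Δ := by
  ext j; simp [latticePoint]

theorem mFourier_latticePoint_zero {d : ℕ} (N : ℕ) (z : Fin d → ℕ) (m : Fin d → ℤ) (k : ℕ) :
    mFourier m (latticePoint N z 0 k) =
      Complex.exp (2 * Real.pi * Complex.I * ((∑ j, m j * (z j : ℤ) : ℤ) : ℂ) / N) ^ k := by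
  rw [← Complex.exp_nat_mul]
  simp only [mFourier, ContinuousMap.coe_mk, latticePoint, Pi.zero_apply, add_zero,
    fourier_coe_apply, ← Complex.exp_sum]
  congr 1
  push_cast
  simp only [Finset.mul_sum, Finset.sum_div]
  refine Finset.sum_congr rfl fun j _ => ?_
  ring

open Classical in
/-- The character sum over the lattice is the indicator of the dual lattice. -/
theorem sum_mFourier_latticePoint_zero {d N : ℕ} (hN : N ≠ 0) (z : Fin d → ℕ) (m : Fin d → ℤ) :
    1 / (N : ℂ) * ∑ k ∈ Finset.range N, mFourier m (latticePoint N z 0 k) =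
      if m ∈ dualLattice N z then 1 else 0 := by
  have hN' : (N : ℂ) ≠ 0 := by exact_mod_cast hN
  simp only [mFourier_latticePoint_zero]
  set M : ℤ := ∑ j, m j * (z j : ℤ) with hM
  have hw : Complex.exp (2 * Real.pi * Complex.I * (M : ℂ) / N) = 1 ↔ m ∈ dualLattice N z := by
    rw [Complex.exp_eq_one_iff]
    change _ ↔ (N : ℤ) ∣ M
    constructor
    · rintro ⟨n, hn⟩
      refine ⟨n, ?_⟩
      have : (M : ℂ) = N * n := by
        field_simp at hn
        exact hn
      exact_mod_cast this
    · rintro ⟨n, hn⟩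
      refine ⟨n, ?_⟩
      rw [hn]; push_cast; field_simp
  split_ifs with h
  · rw [hw.mpr h]; simp [hN']
  · rw [geom_sum_eq (fun h' => h (hw.mp h')), ← Complex.exp_nat_mul]
    have : (N : ℂ) * (2 * Real.pi * Complex.I * (M : ℂ) / N) = M * (2 * Real.pi * Complex.I) := by
      field_simp
    rw [this, Complex.exp_int_mul_two_pi_mul_I]
    simp

open Classical in
theorem latticeCoeff_mFourier {d N : ℕ} (hN : N ≠ 0) (z : Fin d → ℕ) (Δ : UnitAddTorus (Fin d))
    (k h : Fin d → ℤ) :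
    latticeCoeff (mFourier k) N z Δ h =
      if k - h ∈ dualLattice N z then mFourier (k - h) Δ else 0 := by
  unfold latticeCoeff
  simp_rw [← mFourier_add, ← sub_eq_add_neg, latticePoint_eq_add N z Δ, mFourier_apply_add]
  rw [← Finset.sum_mul, ← mul_assoc, sum_mFourier_latticePoint_zero hN]
  split_ifs <;> simp

theorem continuous_latticePoint {d : ℕ} (N : ℕ) (z : Fin d → ℕ) (k : ℕ) :
    Continuous fun Δ : UnitAddTorus (Fin d) => latticePoint N z Δ k := by
  unfold latticePoint; fun_prop

theorem continuous_latticeCoeff {d : ℕ} {f : UnitAddTorus (Fin d) → ℂ} (hf : Continuous f)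
    (N : ℕ) (z : Fin d → ℕ) (h : Fin d → ℤ) :
    Continuous fun Δ => latticeCoeff f N z Δ h := by
  unfold latticeCoeff
  refine continuous_const.mul (continuous_finsetSum _ fun k _ => ?_)
  exact (hf.comp (continuous_latticePoint N z k)).mul
    ((map_continuous _).comp (continuous_latticePoint N z k))

open Classical in
/-- Aliasing: as a function of the shift, the lattice estimate of the `h`-th coefficient has the
Fourier coefficients of `f`, translated by `h` and restricted to the dual lattice. -/
theorem mFourierCoeff_latticeCoeff {d N : ℕ} (hN : N ≠ 0) {f : UnitAddTorus (Fin d) → ℂ}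
    (hf : Continuous f) (z : Fin d → ℕ) (h m : Fin d → ℤ) :
    mFourierCoeff (fun Δ => latticeCoeff f N z Δ h) m =
      if m ∈ dualLattice N z then mFourierCoeff f (h + m) else 0 := by
  have h1 : ∀ k, ∫ t, mFourier (-m) t * (f (latticePoint N z t k) *
      mFourier (-h) (latticePoint N z t k)) ∂(torusMeasure d)
      = mFourier m (latticePoint N z 0 k) * mFourierCoeff f (h + m) := by
    intro k
    set y := latticePoint N z 0 k with hy
    have hadd : ∀ t, latticePoint N z t k = y + t := fun t => latticePoint_eq_add N z t k
    have := mFourierCoeff_translate (fun x => f x * mFourier (-h) x) y m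
    rw [mFourierCoeff_eq_integral_torusMeasure] at this
    simp_rw [hadd]
    rw [this]
    congr 1
    simp only [mFourierCoeff_eq_integral_torusMeasure, neg_add, mFourier_add]
    congr 1 with x
    ring
  have h2 : ∀ k, Integrable (fun t => mFourier (-m) t * (f (latticePoint N z t k) *
      mFourier (-h) (latticePoint N z t k))) (torusMeasure d) := by
    intro k
    have := continuous_latticePoint N z k
    exact integrable_torusMeasure (by fun_prop)
  rw [mFourierCoeff_eq_integral_torusMeasure]
  unfold latticeCoeff
  simp_rw [mul_left_comm _ (1 / (N : ℂ)), Finset.mul_sum (Finset.range N) _ (mFourier (-m) _)]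
  rw [integral_const_mul, integral_finsetSum _ fun k _ => h2 k]
  simp only [h1]
  rw [← Finset.sum_mul, ← mul_assoc, sum_mFourier_latticePoint_zero hN]
  split_ifs <;> simp

theorem latticeCoeff_sub_trigPoly {d : ℕ} (f : UnitAddTorus (Fin d) → ℂ)
    (S : Finset (Fin d → ℤ)) (c : (Fin d → ℤ) → ℂ) (N : ℕ) (z : Fin d → ℕ)
    (Δ : UnitAddTorus (Fin d)) (h : Fin d → ℤ) :
    latticeCoeff (fun x => f x - ∑ k ∈ S, c k * mFourier k x) N z Δ h =
      latticeCoeff f N z Δ h - ∑ k ∈ S, c k * latticeCoeff (mFourier k) N z Δ h := by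
  unfold latticeCoeff
  simp only [sub_mul, Finset.sum_sub_distrib, mul_sub, Finset.sum_mul]
  congr 1
  rw [Finset.sum_comm, Finset.mul_sum]
  refine Finset.sum_congr rfl fun k _ => ?_
  simp only [Finset.mul_sum]
  refine Finset.sum_congr rfl fun i _ => ?_
  ring

/-! ### Hyperbolic crosses -/

section Crosses

variable {d : ℕ} {α : ℝ} {γ : Finset (Fin d) → ℝ}

theorem mem_supp {h : Fin d → ℤ} {j : Fin d} : j ∈ supp h ↔ h j ≠ 0 := by simp [supp]

theorem one_le_abs_of_mem_supp {h : Fin d → ℤ} {j : Fin d} (hj : j ∈ supp h) :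
    1 ≤ |(h j : ℝ)| := by
  exact_mod_cast Int.one_le_abs (mem_supp.mp hj)

theorem one_le_prod_supp (h : Fin d → ℤ) : 1 ≤ ∏ j ∈ supp h, |(h j : ℝ)| :=
  Finset.prod_induction _ (fun x : ℝ => 1 ≤ x) (fun _ _ => one_le_mul_of_one_le_of_one_le) le_rfl
    fun _ => one_le_abs_of_mem_supp

theorem prod_rpow_le_fourierWeight (hγ : IsDownwardClosedWeights γ) (h : Fin d → ℤ) :
    (∏ j ∈ supp h, |(h j : ℝ)|) ^ (2 * α) ≤ fourierWeight α γ h := by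
  rw [fourierWeight, Real.finsetProd_rpow _ _ fun _ _ => abs_nonneg _]
  exact le_mul_of_one_le_left (Real.rpow_nonneg (zero_le_one.trans (one_le_prod_supp h)) _)
    ((one_le_inv₀ (hγ.pos _)).mpr (hγ.le_one _))

theorem one_le_fourierWeight (hα : 0 ≤ α) (hγ : IsDownwardClosedWeights γ) (h : Fin d → ℤ) :
    1 ≤ fourierWeight α γ h :=
  (Real.one_le_rpow (one_le_prod_supp h) (by linarith)).trans (prod_rpow_le_fourierWeight hγ h)

theorem weightedCross_subset_hyperbolicCross (hα : 0 < α) (hγ : IsDownwardClosedWeights γ)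
    {L : ℝ} (hL : 0 ≤ L) : weightedCross α γ L ⊆ hyperbolicCross d L := fun h hh =>
  (Real.rpow_lt_rpow_iff (zero_le_one.trans (one_le_prod_supp h)) hL (by linarith)).mp
    ((prod_rpow_le_fourierWeight hγ h).trans_lt hh)

theorem finite_weightedCross (hα : 0 < α) (hγ : IsDownwardClosedWeights γ)
    {L : ℝ} (hL : 0 ≤ L) : (weightedCross α γ L).Finite :=
  (finite_hyperbolicCross d L).subset (weightedCross_subset_hyperbolicCross hα hγ hL)

/-- Downward-closedness of the weights makes the Fourier weight monotone in every `|h j|`, also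
when entries become zero. -/
theorem fourierWeight_le_of_abs_le (hα : 0 < α) (hγ : IsDownwardClosedWeights γ)
    {h k : Fin d → ℤ} (hhk : ∀ j, |h j| ≤ |k j|) : fourierWeight α γ h ≤ fourierWeight α γ k := by
  have hsub : supp h ⊆ supp k := fun j hj => by
    rw [mem_supp] at hj ⊢
    intro h0
    have := hhk j
    rw [h0, abs_zero] at this
    exact hj (abs_nonpos_iff.mp this)
  refine mul_le_mul (inv_anti₀ (hγ.pos _) (hγ.anti _ _ hsub)) ?_
    (Finset.prod_nonneg fun j _ => Real.rpow_nonneg (abs_nonneg _) _) (inv_nonneg.mpr (hγ.pos _).le)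
  calc ∏ j ∈ supp h, |(h j : ℝ)| ^ (2 * α)
      ≤ ∏ j ∈ supp h, |(k j : ℝ)| ^ (2 * α) := by
        refine Finset.prod_le_prod (fun j _ => Real.rpow_nonneg (abs_nonneg _) _) fun j _ => ?_
        exact Real.rpow_le_rpow (abs_nonneg _) (by exact_mod_cast hhk j) (by linarith)
    _ ≤ ∏ j ∈ supp k, |(k j : ℝ)| ^ (2 * α) := by
        refine Finset.prod_le_prod_of_subset_of_one_le hsub
          (fun j _ => Real.rpow_nonneg (abs_nonneg _) _) fun j hj _ => ?_
        exact Real.one_le_rpow (one_le_abs_of_mem_supp hj) (by linarith)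

/-- The supremum defining `nStar` is over a bounded set: a cross that contains `N` prescribed
frequencies is too large. -/
theorem bddAbove_nStar (hd : 1 ≤ d) (hα : 0 < α) (hγ : IsDownwardClosedWeights γ) {N : ℕ}
    (hN : 0 < N) :
    BddAbove {L : ℝ | 0 ≤ L ∧ ((weightedCross α γ L).ncard : ℝ) ≤ ((N : ℝ) - 1) / 16} := by
  have : Nonempty (Fin d) := ⟨⟨0, hd⟩⟩
  obtain ⟨T, hT⟩ := Infinite.exists_subset_card_eq (Fin d → ℤ) N
  have hpos : ∀ h, 0 ≤ fourierWeight α γ h := fun h =>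
    zero_le_one.trans (one_le_fourierWeight hα.le hγ h)
  have hM : 0 ≤ ∑ h ∈ T, fourierWeight α γ h := Finset.sum_nonneg fun h _ => hpos h
  refine ⟨(∑ h ∈ T, fourierWeight α γ h) ^ (2 * α)⁻¹, fun L hL => ?_⟩
  by_contra hlt
  rw [not_le, Real.rpow_inv_lt_iff_of_pos hM hL.1 (by linarith)] at hlt
  have hsub : (T : Set (Fin d → ℤ)) ⊆ weightedCross α γ L := fun h hh =>
    (Finset.single_le_sum (fun k _ => hpos k) hh).trans_lt hlt
  have hcard := Set.ncard_le_ncard hsub (finite_weightedCross hα hγ hL.1)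
  rw [Set.ncard_coe_finset, hT] at hcard
  have h1 : (N : ℝ) ≤ (weightedCross α γ L).ncard := by exact_mod_cast hcard
  have h2 : (0 : ℝ) < N := by exact_mod_cast hN
  linarith [hL.2]

theorem one_le_nStar (hd : 1 ≤ d) (hα : 0 < α) (hγ : IsDownwardClosedWeights γ) {N : ℕ}
    (hN : 0 < N) : 1 ≤ nStar α γ N := by
  refine le_csSup (bddAbove_nStar hd hα hγ hN) ⟨zero_le_one, ?_⟩
  have : weightedCross α γ 1 = ∅ := by
    ext h
    simpa [weightedCross] using one_le_fourierWeight hα.le hγ h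
  have h1 : (1 : ℝ) ≤ N := by exact_mod_cast hN
  rw [this, Set.ncard_empty, Nat.cast_zero]
  linarith

/-- The supremum defining `nStar` is attained, because the crosses are left-continuous in `L`. -/
theorem ncard_weightedCross_nStar_le (hd : 1 ≤ d) (hα : 0 < α) (hγ : IsDownwardClosedWeights γ)
    {N : ℕ} (hN : 0 < N) :
    ((weightedCross α γ (nStar α γ N)).ncard : ℝ) ≤ ((N : ℝ) - 1) / 16 := by
  have hs0 : 0 ≤ nStar α γ N := zero_le_one.trans (one_le_nStar hd hα hγ hN)
  have hfin := finite_weightedCross hα hγ hs0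
  rcases (weightedCross α γ (nStar α γ N)).eq_empty_or_nonempty with he | hne
  · have h1 : (1 : ℝ) ≤ N := by exact_mod_cast hN
    rw [he, Set.ncard_empty, Nat.cast_zero]
    linarith
  · obtain ⟨k, hk, hmax⟩ := Set.exists_max_image _ (fourierWeight α γ) hfin hne
    have hk0 : 0 ≤ fourierWeight α γ k := zero_le_one.trans (one_le_fourierWeight hα.le hγ k)
    have h2α : 0 < 2 * α := by linarith
    have hlt : fourierWeight α γ k ^ (2 * α)⁻¹ < nStar α γ N :=
      (Real.rpow_inv_lt_iff_of_pos hk0 hs0 h2α).mpr hk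
    have hne' : {L : ℝ | 0 ≤ L ∧
        ((weightedCross α γ L).ncard : ℝ) ≤ ((N : ℝ) - 1) / 16}.Nonempty := by
      by_contra hemp
      rw [Set.not_nonempty_iff_eq_empty] at hemp
      have h1 := one_le_nStar hd hα hγ hN
      rw [nStar, hemp, Real.sSup_empty] at h1
      linarith
    obtain ⟨L, hL, hkL⟩ := exists_lt_of_lt_csSup hne' hlt
    rw [Real.rpow_inv_lt_iff_of_pos hk0 hL.1 h2α] at hkL
    have hsub : weightedCross α γ (nStar α γ N) ⊆ weightedCross α γ L := fun h hh =>
      (hmax h hh).trans_lt hkL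
    refine le_trans ?_ hL.2
    exact_mod_cast Set.ncard_le_ncard hsub (finite_weightedCross hα hγ hL.1)

/-- With `k` the weighted cross contains the whole box spanned by `k`, which has
`∏ (2 |k j| + 1)` elements; so a weighted cross with at most `N / 16` elements lies in the
hyperbolic cross of size `N / 2`. -/
theorem weightedCross_nStar_subset (hd : 1 ≤ d) (hα : 0 < α) (hγ : IsDownwardClosedWeights γ)
    {N : ℕ} (hN : 0 < N) :
    weightedCross α γ (nStar α γ N) ⊆ hyperbolicCross d ((N : ℝ) / 2) := by
  intro k hk
  have hs0 : 0 ≤ nStar α γ N := zero_le_one.trans (one_le_nStar hd hα hγ hN)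
  set box := Finset.Icc (fun j => -|k j|) (fun j => |k j|) with hbox
  have hsub : (box : Set (Fin d → ℤ)) ⊆ weightedCross α γ (nStar α γ N) := by
    intro h hh
    rw [hbox, Finset.mem_coe, Finset.mem_Icc] at hh
    exact (fourierWeight_le_of_abs_le hα hγ fun j => abs_le.mpr ⟨hh.1 j, hh.2 j⟩).trans_lt hk
  have hcard : (box.card : ℝ) ≤ ((N : ℝ) - 1) / 16 := by
    refine le_trans ?_ (ncard_weightedCross_nStar_le hd hα hγ hN)
    rw [← Set.ncard_coe_finset]
    exact_mod_cast Set.ncard_le_ncard hsub (finite_weightedCross hα hγ hs0)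
  have hprod : ∏ j ∈ supp k, |(k j : ℝ)| ≤ box.card := by
    rw [hbox, Pi.card_Icc, Nat.cast_prod]
    have hj : ∀ j, ((Finset.Icc (-|k j|) |k j|).card : ℝ) = 2 * |(k j : ℝ)| + 1 := by
      intro j
      have h0 : 0 ≤ |k j| := abs_nonneg _
      rw [Int.card_Icc]
      have : (((|k j| + 1 - -|k j|).toNat : ℤ) : ℝ) = ((2 * |k j| + 1 : ℤ) : ℝ) := by
        congr 1; omega
      push_cast at this ⊢
      exact this
    calc ∏ j ∈ supp k, |(k j : ℝ)|
        ≤ ∏ j ∈ supp k, ((Finset.Icc (-|k j|) |k j|).card : ℝ) := by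
          refine Finset.prod_le_prod (fun j _ => abs_nonneg _) fun j _ => ?_
          rw [hj]; linarith [abs_nonneg (k j : ℝ)]
      _ ≤ ∏ j, ((Finset.Icc (-|k j|) |k j|).card : ℝ) := by
          refine Finset.prod_le_prod_of_subset_of_one_le (Finset.subset_univ _)
            (fun j _ => Nat.cast_nonneg _) fun j _ _ => ?_
          rw [hj]; linarith [abs_nonneg (k j : ℝ)]
  have h1 : (1 : ℝ) ≤ N := by exact_mod_cast hN
  change ∏ j ∈ supp k, |(k j : ℝ)| < (N : ℝ) / 2
  linarith

/-- The hyperbolic cross of size `N / 2` contains at most one frequency of each residue class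
modulo `N`. -/
theorem eq_of_mem_hyperbolicCross_of_dvd {N : ℕ} (hN : 0 < N) {h k : Fin d → ℤ}
    (hh : h ∈ hyperbolicCross d ((N : ℝ) / 2)) (hk : k ∈ hyperbolicCross d ((N : ℝ) / 2))
    (hdvd : ∀ j, (N : ℤ) ∣ k j - h j) : h = k := by
  have h1 : (0 : ℝ) < N := by exact_mod_cast hN
  have hb : ∀ {h : Fin d → ℤ}, h ∈ hyperbolicCross d ((N : ℝ) / 2) →
      ∀ j, |(h j : ℝ)| < (N : ℝ) / 2 := by
    intro h hh j
    by_cases hj : h j = 0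
    · rw [hj, Int.cast_zero, abs_zero]; linarith
    · exact abs_lt_of_mem_hyperbolicCross hh j hj
  ext j
  have hlt : |k j - h j| < N := by
    have : |(k j : ℝ) - h j| < N := by
      linarith [abs_sub (k j : ℝ) (h j), hb hh j, hb hk j]
    exact_mod_cast this
  have := Int.eq_zero_of_abs_lt_dvd (hdvd j) hlt
  omega

end Crosses

/-! ### Random generating vectors -/

theorem generatingVectors_eq_coe (N d : ℕ) : generatingVectors N d =
    ((Fintype.piFinset fun _ : Fin d => Finset.Icc 1 (N - 1) : Finset (Fin d → ℕ)) :
      Set (Fin d → ℕ)) := by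
  ext z; simp [generatingVectors]

theorem isProbabilityMeasure_uniformOn_generatingVectors (d : ℕ) {N : ℕ} (hN : 2 ≤ N) :
    IsProbabilityMeasure (uniformOn (generatingVectors N d)) := by
  refine isProbabilityMeasure_uniformOn ?_ ⟨fun _ => 1, ?_⟩
  · rw [generatingVectors_eq_coe]; exact Finset.finite_toSet _
  · rw [generatingVectors_eq_coe, Finset.mem_coe, Fintype.mem_piFinset]
    intro _
    rw [Finset.mem_Icc]
    omega

open Classical in
/-- Given all entries of `z` but the `j`-th, where `N ∤ m j`, at most one value of the `j`-th
entry puts `m` in the dual lattice. -/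
theorem card_filter_mem_dualLattice_mul_le {d N : ℕ} (hN : N.Prime) {m : Fin d → ℤ} {j : Fin d}
    (hj : ¬ (N : ℤ) ∣ m j) :
    ((Fintype.piFinset fun _ : Fin d => Finset.Icc 1 (N - 1)).filter
        fun z => m ∈ dualLattice N z).card * (N - 1) ≤
      (Fintype.piFinset fun _ : Fin d => Finset.Icc 1 (N - 1)).card := by
  have hcard : (Finset.Icc 1 (N - 1)).card = N - 1 := by simp
  conv_lhs => rw [← hcard]
  rw [← Finset.card_product]
  refine Finset.card_le_card_of_injOn (fun p => Function.update p.1 j p.2) ?_ ?_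
  · rintro ⟨z, a⟩ hp
    rw [Finset.mem_coe, Finset.mem_product, Finset.mem_filter, Fintype.mem_piFinset] at hp
    rw [Finset.mem_coe, Fintype.mem_piFinset]
    intro i
    by_cases hi : i = j
    · subst hi; simpa using hp.2
    · simpa [hi] using hp.1.1 i
  · rintro ⟨z, a⟩ hp ⟨z', a'⟩ hp' heq
    rw [Finset.mem_coe, Finset.mem_product, Finset.mem_filter, Fintype.mem_piFinset] at hp hp'
    dsimp only at hp hp' heq
    have ha : a = a' := by simpa using congrFun heq j
    have hz : ∀ i, i ≠ j → z i = z' i := fun i hi => by simpa [hi] using congrFun heq i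
    have hdiff : ∑ i, m i * (z i : ℤ) - ∑ i, m i * (z' i : ℤ) = m j * ((z j : ℤ) - z' j) := by
      rw [← Finset.sum_sub_distrib, Finset.sum_eq_single j]
      · ring
      · intro i _ hi; rw [hz i hi, sub_self]
      · simp
    have hdvd : (N : ℤ) ∣ m j * ((z j : ℤ) - z' j) := hdiff ▸ dvd_sub hp.1.2 hp'.1.2
    have h1 := ((Nat.prime_iff_prime_int.mp hN).dvd_or_dvd hdvd).resolve_left hj
    have b := Finset.mem_Icc.mp (hp.1.1 j)
    have b' := Finset.mem_Icc.mp (hp'.1.1 j)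
    have h2 := Int.eq_zero_of_abs_lt_dvd h1 (by rw [abs_lt]; omega)
    have hzz : z = z' := by
      ext i
      by_cases hi : i = j
      · subst hi; omega
      · exact hz i hi
    rw [hzz, ha]

/-- A frequency that is nonzero modulo `N` lies in a random dual lattice with probability at most
`1 / (N - 1)`. -/
theorem uniformOn_mem_dualLattice_le {d N : ℕ} (hN : N.Prime) {m : Fin d → ℤ} {j : Fin d}
    (hj : ¬ (N : ℤ) ∣ m j) :
    uniformOn (generatingVectors N d) {z | m ∈ dualLattice N z} ≤ ((N - 1 : ℕ) : ENNReal)⁻¹ := by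
  classical
  have h2 := hN.two_le
  set Gf := Fintype.piFinset fun _ : Fin d => Finset.Icc 1 (N - 1) with hGf
  have hG : generatingVectors N d = (Gf : Set (Fin d → ℕ)) := generatingVectors_eq_coe N d
  have hinter : (Gf : Set (Fin d → ℕ)) ∩ {z | m ∈ dualLattice N z} =
      (Gf.filter fun z => m ∈ dualLattice N z : Finset (Fin d → ℕ)) := by
    ext z; simp
  have hcard := card_filter_mem_dualLattice_mul_le hN hj
  rw [← hGf] at hcard
  have hpos : 0 < Gf.card := by
    rw [hGf, Fintype.card_piFinset]
    refine Finset.prod_pos fun i _ => ?_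
    simp only [Nat.card_Icc]
    omega
  rw [hG, uniformOn, cond_apply Gf.measurableSet, hinter, Measure.count_apply_finset,
    Measure.count_apply_finset, ENNReal.le_inv_iff_mul_le, mul_assoc, mul_comm]
  refine ENNReal.div_le_of_le_mul ?_
  rw [one_mul]
  exact_mod_cast hcard

/-! ### The variance of a single estimate -/

open Classical in
/-- For a fixed generating vector the mean squared error over the random shift is the sum of the
squared aliased coefficients. -/
theorem lintegral_sq_latticeCoeff_sub {d N : ℕ} (hN : N ≠ 0) {g : UnitAddTorus (Fin d) → ℂ}
    (hg : Continuous g) (z : Fin d → ℕ) (h : Fin d → ℤ) :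
    ∫⁻ Δ, ENNReal.ofReal (‖latticeCoeff g N z Δ h - mFourierCoeff g h‖ ^ 2) ∂(torusMeasure d) =
      ∑' m, if m ∈ dualLattice N z ∧ m ≠ 0 then ENNReal.ofReal (‖mFourierCoeff g (h + m)‖ ^ 2)
        else 0 := by
  have hL := continuous_latticeCoeff hg N z h
  have hc : Continuous fun Δ => latticeCoeff g N z Δ h - mFourierCoeff g h :=
    hL.sub continuous_const
  have hconst : ∀ m, mFourierCoeff (fun _ : UnitAddTorus (Fin d) => mFourierCoeff g h) m =
      if m = 0 then mFourierCoeff g h else 0 := fun m => by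
    have := mFourierCoeff_trigPoly {0} (fun _ => mFourierCoeff g h) m
    simpa [mFourier_zero] using this
  have h0 : (0 : Fin d → ℤ) ∈ dualLattice N z := by simp [dualLattice]
  have hcoeff : ∀ m, mFourierCoeff (fun Δ => latticeCoeff g N z Δ h - mFourierCoeff g h) m =
      if m ∈ dualLattice N z ∧ m ≠ 0 then mFourierCoeff g (h + m) else 0 := by
    intro m
    rw [mFourierCoeff_sub hL continuous_const, mFourierCoeff_latticeCoeff hN hg, hconst]
    by_cases hm : m = 0
    · subst hm; simp [h0]
    · simp [hm]
  have hP := hasSum_sq_mFourierCoeff_of_continuous hc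
  have hint : Integrable (fun Δ => ‖latticeCoeff g N z Δ h - mFourierCoeff g h‖ ^ 2)
      (torusMeasure d) :=
    (hc.norm.pow 2).integrable_of_hasCompactSupport (HasCompactSupport.of_compactSpace _)
  rw [← ofReal_integral_eq_lintegral_ofReal hint (ae_of_all _ fun _ => sq_nonneg _), ← hP.tsum_eq,
    ENNReal.ofReal_tsum_of_nonneg (fun _ => sq_nonneg _) hP.summable]
  refine tsum_congr fun m => ?_
  rw [hcoeff]
  split_ifs <;> simp

open Classical in
/-- The part of the squared `ℓ₂` norm of the Fourier coefficients of `g` that sits on the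
frequencies other than `h` congruent to `h` modulo `N`; these are aliased to `h` by every
generating vector. -/
noncomputable def congruentMass {d : ℕ} (g : UnitAddTorus (Fin d) → ℂ) (N : ℕ)
    (h : Fin d → ℤ) : ℝ :=
  ∑' k, if k ≠ h ∧ ∀ j, (N : ℤ) ∣ k j - h j then ‖mFourierCoeff g k‖ ^ 2 else 0

/-- A bound for the mean squared error of the estimate of the `h`-th coefficient of `g`. -/
noncomputable def varianceBound {d : ℕ} (g : UnitAddTorus (Fin d) → ℂ) (N : ℕ)
    (h : Fin d → ℤ) : ℝ :=
  (∑' k, ‖mFourierCoeff g k‖ ^ 2) / ((N : ℝ) - 1) + congruentMass g N h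

theorem congruentMass_nonneg {d : ℕ} (g : UnitAddTorus (Fin d) → ℂ) (N : ℕ) (h : Fin d → ℤ) :
    0 ≤ congruentMass g N h :=
  tsum_nonneg fun _ => by split_ifs <;> positivity

theorem varianceBound_nonneg {d N : ℕ} (hN : 1 ≤ N) (g : UnitAddTorus (Fin d) → ℂ)
    (h : Fin d → ℤ) : 0 ≤ varianceBound g N h := by
  have : (1 : ℝ) ≤ N := by exact_mod_cast hN
  exact add_nonneg (div_nonneg (tsum_nonneg fun _ => sq_nonneg _) (by linarith))
    (congruentMass_nonneg g N h)

/-- The mean squared error over both the generating vector and the shift. -/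
theorem lintegral_lintegral_sq_latticeCoeff_sub_le {d N : ℕ} (hN : N.Prime)
    {g : UnitAddTorus (Fin d) → ℂ} (hg : Continuous g) (h : Fin d → ℤ) :
    ∫⁻ z, ∫⁻ Δ, ENNReal.ofReal (‖latticeCoeff g N z Δ h - mFourierCoeff g h‖ ^ 2)
        ∂(torusMeasure d) ∂(uniformOn (generatingVectors N d)) ≤
      ENNReal.ofReal (varianceBound g N h) := by
  classical
  have h2 := hN.two_le
  have := isProbabilityMeasure_uniformOn_generatingVectors d h2
  have hs := (hasSum_sq_mFourierCoeff_of_continuous hg).summable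
  have hs' : Summable fun k => if k ≠ h ∧ ∀ j, (N : ℤ) ∣ k j - h j then
      ‖mFourierCoeff g k‖ ^ 2 else 0 := by
    refine Summable.of_nonneg_of_le (fun k => ?_) (fun k => ?_) hs
    · split_ifs <;> positivity
    · split_ifs
      · exact le_rfl
      · positivity
  have hN1 : ((N - 1 : ℕ) : ℝ) = (N : ℝ) - 1 := by rw [Nat.cast_sub (by omega)]; simp
  have hpos : (0 : ℝ) < (N - 1 : ℕ) := by exact_mod_cast (by omega : 0 < N - 1)
  have hV : ENNReal.ofReal (varianceBound g N h) =
      ∑' m, (ENNReal.ofReal (‖mFourierCoeff g (h + m)‖ ^ 2) * ((N - 1 : ℕ) : ENNReal)⁻¹ +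
        if m ≠ 0 ∧ ∀ j, (N : ℤ) ∣ m j then ENNReal.ofReal (‖mFourierCoeff g (h + m)‖ ^ 2)
        else 0) := by
    have e : ((N - 1 : ℕ) : ENNReal)⁻¹ = ENNReal.ofReal ((N - 1 : ℕ) : ℝ)⁻¹ := by
      rw [ENNReal.ofReal_inv_of_pos hpos, ENNReal.ofReal_natCast]
    rw [varianceBound, ← hN1, div_eq_mul_inv, ENNReal.ofReal_add
      (mul_nonneg (tsum_nonneg fun _ => sq_nonneg _) (inv_nonneg.mpr hpos.le))
      (congruentMass_nonneg g N h), congruentMass,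
      ENNReal.ofReal_mul (tsum_nonneg fun _ => sq_nonneg _),
      ENNReal.ofReal_tsum_of_nonneg (fun _ => sq_nonneg _) hs,
      ENNReal.ofReal_tsum_of_nonneg (fun k => by split_ifs <;> positivity) hs', ← e,
      ← ENNReal.tsum_mul_right, ← ENNReal.tsum_add, ← (Equiv.addLeft h).tsum_eq]
    refine tsum_congr fun m => ?_
    congr 1
    simp only [Equiv.coe_addLeft, Pi.add_apply, add_sub_cancel_left, ne_eq, add_eq_left]
    split_ifs <;> simp
  simp_rw [lintegral_sq_latticeCoeff_sub hN.ne_zero hg]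
  rw [lintegral_tsum fun m => (measurable_of_countable _).aemeasurable, hV]
  refine ENNReal.tsum_le_tsum fun m => ?_
  set c := ENNReal.ofReal (‖mFourierCoeff g (h + m)‖ ^ 2) with hc
  by_cases hm : ∀ j, (N : ℤ) ∣ m j
  · refine le_trans ?_ le_add_self
    calc ∫⁻ z, (if m ∈ dualLattice N z ∧ m ≠ 0 then c else 0) ∂(uniformOn (generatingVectors N d))
        ≤ ∫⁻ _, (if m ≠ 0 ∧ ∀ j, (N : ℤ) ∣ m j then c else 0)
            ∂(uniformOn (generatingVectors N d)) := by
          refine lintegral_mono fun z => ?_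
          by_cases hm0 : m = 0
          · simp [hm0]
          · simp only [ne_eq, hm0, not_false_eq_true, and_true, hm, implies_true, if_true]
            split_ifs <;> simp
      _ = _ := by rw [lintegral_const, measure_univ, mul_one]
  · refine le_trans ?_ le_self_add
    obtain ⟨j, hj⟩ := not_forall.mp hm
    calc ∫⁻ z, (if m ∈ dualLattice N z ∧ m ≠ 0 then c else 0) ∂(uniformOn (generatingVectors N d))
        ≤ ∫⁻ z, ({z | m ∈ dualLattice N z}.indicator fun _ => c) z
            ∂(uniformOn (generatingVectors N d)) := by
          refine lintegral_mono fun z => ?_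
          simp only [Set.indicator, Set.mem_ofPred_eq]
          split_ifs <;> simp_all
      _ = c * uniformOn (generatingVectors N d) {z | m ∈ dualLattice N z} := by
          rw [lintegral_indicator_const (Set.to_countable _).measurableSet]
      _ ≤ _ := by gcongr; exact uniformOn_mem_dualLattice_le hN hj

/-! ### The failure probability of a single estimate -/

/-- Markov's inequality with strict inequality, valid also when the mean vanishes. -/
theorem measure_mul_lt_le_inv {Ω : Type*} [MeasurableSpace Ω] {μ : Measure Ω} {X : Ω → ENNReal}
    (hX : Measurable X) {v c : ENNReal} (hv : v ≠ ⊤)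
    (hle : ∫⁻ x, X x ∂μ ≤ v) : μ {x | c * v < X x} ≤ c⁻¹ := by
  rcases eq_or_ne v 0 with rfl | hv0
  · have h0 := (lintegral_eq_zero_iff hX).mp (le_antisymm hle zero_le)
    have : μ {x | c * 0 < X x} = 0 := by
      rw [mul_zero]
      refine measure_mono_null (fun x hx => ?_) h0
      exact (ne_of_gt hx)
    rw [this]; exact zero_le
  · have h1 : c * v * μ {x | c * v ≤ X x} ≤ v := (mul_meas_ge_le_lintegral hX _).trans hle
    have h2 : c * μ {x | c * v < X x} * v ≤ v := by
      refine le_trans ?_ h1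
      rw [mul_right_comm]
      gcongr
      exact fun hx => le_of_lt hx
    rw [← ENNReal.le_div_iff_mul_le (Or.inl hv0) (Or.inl hv), ENNReal.div_self hv0 hv] at h2
    rwa [ENNReal.le_inv_iff_mul_le, mul_comm]

/-- The draws for which the estimate of the `h`-th coefficient of `f` has squared error above
`E`. -/
def badDraws {d : ℕ} (f : UnitAddTorus (Fin d) → ℂ) (N : ℕ) (h : Fin d → ℤ) (E : ℝ) :
    Set ((Fin d → ℕ) × UnitAddTorus (Fin d)) :=
  {p | E < ‖latticeCoeff f N p.1 p.2 h - mFourierCoeff f h‖ ^ 2}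

theorem measurable_sq_latticeCoeff_sub {d : ℕ} {f : UnitAddTorus (Fin d) → ℂ} (hf : Continuous f)
    (N : ℕ) (h : Fin d → ℤ) :
    Measurable fun p : (Fin d → ℕ) × UnitAddTorus (Fin d) =>
      ‖latticeCoeff f N p.1 p.2 h - mFourierCoeff f h‖ ^ 2 := by
  refine measurable_from_prod_countable_right fun z => ?_
  exact (((continuous_latticeCoeff hf N z h).sub continuous_const).norm.pow 2).measurable

theorem measurableSet_badDraws {d : ℕ} {f : UnitAddTorus (Fin d) → ℂ} (hf : Continuous f)
    (N : ℕ) (h : Fin d → ℤ) (E : ℝ) : MeasurableSet (badDraws f N h E) :=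
  measurableSet_lt measurable_const (measurable_sq_latticeCoeff_sub hf N h)

/-- `f` without its Fourier modes in `S`. -/
noncomputable def removeModes {d : ℕ} (S : Finset (Fin d → ℤ)) (f : UnitAddTorus (Fin d) → ℂ)
    (x : UnitAddTorus (Fin d)) : ℂ :=
  f x - ∑ k ∈ S, mFourierCoeff f k * mFourier k x

theorem continuous_removeModes {d : ℕ} (S : Finset (Fin d → ℤ)) {f : UnitAddTorus (Fin d) → ℂ}
    (hf : Continuous f) : Continuous (removeModes S f) := by
  unfold removeModes; fun_prop

open Classical in
theorem mFourierCoeff_removeModes {d : ℕ} (S : Finset (Fin d → ℤ)) {f : UnitAddTorus (Fin d) → ℂ}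
    (hf : Continuous f) (k : Fin d → ℤ) :
    mFourierCoeff (removeModes S f) k = if k ∈ S then 0 else mFourierCoeff f k := by
  unfold removeModes
  rw [mFourierCoeff_sub hf (by fun_prop), mFourierCoeff_trigPoly]
  split_ifs <;> simp

/-- If no mode in `S` is aliased to `h`, then the modes in `S` do not contribute to the error of
the estimate of the `h`-th coefficient. -/
theorem latticeCoeff_sub_eq_removeModes {d N : ℕ} (hN : N ≠ 0) {f : UnitAddTorus (Fin d) → ℂ}
    (hf : Continuous f) {S : Finset (Fin d → ℤ)} {z : Fin d → ℕ} {h : Fin d → ℤ}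
    (hz : ∀ k ∈ S, k ≠ h → k - h ∉ dualLattice N z) (Δ : UnitAddTorus (Fin d)) :
    latticeCoeff f N z Δ h - mFourierCoeff f h =
      latticeCoeff (removeModes S f) N z Δ h - mFourierCoeff (removeModes S f) h := by
  classical
  have h1 : ∑ k ∈ S, mFourierCoeff f k * latticeCoeff (mFourier k) N z Δ h =
      if h ∈ S then mFourierCoeff f h else 0 := by
    rw [← Finset.sum_ite_eq S h]
    refine Finset.sum_congr rfl fun k hk => ?_
    rw [latticeCoeff_mFourier hN]
    by_cases hkh : k = h
    · subst hkh
      simp [dualLattice, mFourier_zero]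
    · rw [if_neg (hz k hk hkh), if_neg (Ne.symm hkh), mul_zero]
  have h2 := latticeCoeff_sub_trigPoly f S (mFourierCoeff f) N z Δ h
  rw [h1] at h2
  rw [mFourierCoeff_removeModes S hf]
  unfold removeModes
  rw [h2]
  split_ifs <;> simp

/-- Both sources of failure have probability at most `1 / 16`: aliasing of one of the at most
`(N - 1) / 16` modes in `S`, and a large contribution of the remaining modes. -/
theorem measure_badDraws_le {d N : ℕ} (hN : N.Prime) {f : UnitAddTorus (Fin d) → ℂ}
    (hf : Continuous f) {S : Finset (Fin d → ℤ)} (hS : (S.card : ℝ) ≤ ((N : ℝ) - 1) / 16)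
    {h : Fin d → ℤ} (hSh : ∀ k ∈ S, k ≠ h → ∃ j, ¬ (N : ℤ) ∣ k j - h j) :
    (uniformOn (generatingVectors N d)).prod (torusMeasure d)
      (badDraws f N h (16 * varianceBound (removeModes S f) N h)) ≤ 8⁻¹ := by
  classical
  have h2 := hN.two_le
  have := isProbabilityMeasure_uniformOn_generatingVectors d h2
  set g := removeModes S f with hg
  have hgc : Continuous g := continuous_removeModes S hf
  set ν := uniformOn (generatingVectors N d) with hν
  have hmeas := (measurable_sq_latticeCoeff_sub hgc N h).ennreal_ofReal
  set U : Set (Fin d → ℕ) := ⋃ k ∈ S.filter (· ≠ h), {z | k - h ∈ dualLattice N z} with hU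
  have hsub : badDraws f N h (16 * varianceBound g N h) ⊆ U ×ˢ Set.univ ∪
      {p | 16 * ENNReal.ofReal (varianceBound g N h) <
        ENNReal.ofReal (‖latticeCoeff g N p.1 p.2 h - mFourierCoeff g h‖ ^ 2)} := by
    rintro ⟨z, Δ⟩ hp
    by_cases hz : z ∈ U
    · exact Or.inl ⟨hz, trivial⟩
    · right
      have hz' : ∀ k ∈ S, k ≠ h → k - h ∉ dualLattice N z := fun k hk hkh hmem =>
        hz (Set.mem_biUnion (Finset.mem_coe.mpr (Finset.mem_filter.mpr ⟨hk, hkh⟩)) hmem)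
      change 16 * varianceBound g N h < ‖latticeCoeff f N z Δ h - mFourierCoeff f h‖ ^ 2 at hp
      rw [latticeCoeff_sub_eq_removeModes hN.ne_zero hf hz'] at hp
      have h16 : (16 : ENNReal) = ENNReal.ofReal 16 := by simp
      rw [Set.mem_ofPred_eq, h16, ← ENNReal.ofReal_mul (by norm_num)]
      exact (ENNReal.ofReal_lt_ofReal_iff_of_nonneg
        (mul_nonneg (by norm_num) (varianceBound_nonneg (by omega) g h))).mpr hp
  have hPU : ν U ≤ 16⁻¹ := by
    calc ν U ≤ ∑ k ∈ S.filter (· ≠ h), ν {z | k - h ∈ dualLattice N z} :=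
          measure_biUnion_finset_le _ _
      _ ≤ ∑ _k ∈ S.filter (· ≠ h), ((N - 1 : ℕ) : ENNReal)⁻¹ := by
          refine Finset.sum_le_sum fun k hk => ?_
          rw [Finset.mem_filter] at hk
          obtain ⟨j, hj⟩ := hSh k hk.1 hk.2
          exact uniformOn_mem_dualLattice_le (j := j) hN hj
      _ ≤ S.card * ((N - 1 : ℕ) : ENNReal)⁻¹ := by
          rw [Finset.sum_const, nsmul_eq_mul]
          gcongr
          exact Finset.filter_subset _ _
      _ ≤ 16⁻¹ := by
          have hc : 16 * S.card ≤ N - 1 := by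
            have : ((16 * S.card + 1 : ℕ) : ℝ) ≤ N := by push_cast; linarith
            have : 16 * S.card + 1 ≤ N := by exact_mod_cast this
            omega
          rw [ENNReal.le_inv_iff_mul_le, mul_right_comm]
          refine ENNReal.div_le_of_le_mul ?_
          rw [one_mul, mul_comm]
          exact_mod_cast hc
  have hPV : ν.prod (torusMeasure d) {p | 16 * ENNReal.ofReal (varianceBound g N h) <
        ENNReal.ofReal (‖latticeCoeff g N p.1 p.2 h - mFourierCoeff g h‖ ^ 2)} ≤ 16⁻¹ := by
    refine measure_mul_lt_le_inv hmeas ENNReal.ofReal_ne_top ?_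
    rw [lintegral_prod _ hmeas.aemeasurable]
    exact lintegral_lintegral_sq_latticeCoeff_sub_le hN hgc h
  calc ν.prod (torusMeasure d) (badDraws f N h (16 * varianceBound g N h))
      ≤ ν.prod (torusMeasure d) (U ×ˢ Set.univ) + _ :=
        (measure_mono hsub).trans (measure_union_le _ _)
    _ ≤ 16⁻¹ + 16⁻¹ := by
        rw [Measure.prod_prod, measure_univ, mul_one]
        exact add_le_add hPU hPV
    _ = 8⁻¹ := by
        rw [← two_mul, show (16 : ENNReal) = 2 * 8 by norm_num,
          ENNReal.mul_inv (by simp) (by simp), ← mul_assoc,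
          ENNReal.mul_inv_cancel (by simp) (by simp), one_mul]

/-! ### Boosting by the majority of independent draws -/

theorem measurableSet_majority {Ω : Type*} [MeasurableSpace Ω] {B : Set Ω} (hB : MeasurableSet B)
    [DecidablePred (· ∈ B)] (R : ℕ) :
    MeasurableSet {ω : Fin R → Ω | R < 2 * (Finset.univ.filter fun r => ω r ∈ B).card} := by
  have hm : Measurable fun ω : Fin R → Ω => (Finset.univ.filter fun r => ω r ∈ B).card := by
    simp only [Finset.card_filter]
    refine Finset.measurable_fun_sum _ fun r _ => ?_
    exact Measurable.ite (measurable_pi_apply r hB) measurable_const measurable_const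
  exact measurableSet_lt measurable_const (measurable_const.mul hm)

/-- If a single draw fails with probability at most `1 / 8`, then a union bound over the sets of
`(R + 1) / 2` draws bounds the probability that a majority of the draws fails. -/
theorem measure_pi_majority_le {Ω : Type*} [MeasurableSpace Ω] {μ : Measure Ω}
    [IsProbabilityMeasure μ] {B : Set Ω} [DecidablePred (· ∈ B)] (hμB : μ B ≤ 8⁻¹)
    {R : ℕ} (hR : Odd R) :
    Measure.pi (fun _ : Fin R => μ)
        {ω : Fin R → Ω | R < 2 * (Finset.univ.filter fun r => ω r ∈ B).card} ≤
      ENNReal.ofReal (1 / 2 * (1 / 2 : ℝ) ^ ((R : ℝ) / 2)) := by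
  obtain ⟨n, rfl⟩ := hR
  have hsub : {ω : Fin (2 * n + 1) → Ω |
        2 * n + 1 < 2 * (Finset.univ.filter fun r => ω r ∈ B).card} ⊆
      ⋃ T ∈ Finset.univ.powersetCard (n + 1),
        Set.pi Set.univ fun r : Fin (2 * n + 1) => if r ∈ T then B else Set.univ := by
    intro ω hω
    rw [Set.mem_ofPred_eq] at hω
    obtain ⟨T, hT, hcard⟩ := Finset.exists_subset_card_eq
      (show n + 1 ≤ (Finset.univ.filter fun r => ω r ∈ B).card by omega)
    refine Set.mem_biUnion (Finset.mem_coe.mpr (Finset.mem_powersetCard.mpr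
      ⟨Finset.subset_univ T, hcard⟩)) fun r _ => ?_
    dsimp only
    split_ifs with hr
    · exact (Finset.mem_filter.mp (hT hr)).2
    · trivial
  have hpow : ((4 : ℝ) ^ n * (8⁻¹) ^ (n + 1)) ≤
      1 / 2 * (1 / 2 : ℝ) ^ (((2 * n + 1 : ℕ) : ℝ) / 2) := by
    have h1 : (1 / 2 : ℝ) ^ (n + 1) ≤ (1 / 2 : ℝ) ^ (((2 * n + 1 : ℕ) : ℝ) / 2) := by
      rw [← Real.rpow_natCast]
      refine Real.rpow_le_rpow_of_exponent_ge (by norm_num) (by norm_num) ?_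
      push_cast; linarith
    have h2 : (4 : ℝ) ^ n * (8⁻¹) ^ (n + 1) = 1 / 4 * (1 / 2 : ℝ) ^ (n + 1) := by
      rw [pow_succ, pow_succ, ← mul_assoc, ← mul_pow]
      norm_num
      ring
    have h3 : (0 : ℝ) < (1 / 2 : ℝ) ^ (n + 1) := by positivity
    rw [h2]
    linarith
  calc _ ≤ ∑ T ∈ Finset.univ.powersetCard (n + 1), Measure.pi (fun _ : Fin (2 * n + 1) => μ)
          (Set.pi Set.univ fun r : Fin (2 * n + 1) => if r ∈ T then B else Set.univ) :=
        (measure_mono hsub).trans (measure_biUnion_finset_le _ _)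
    _ ≤ ∑ T ∈ (Finset.univ : Finset (Fin (2 * n + 1))).powersetCard (n + 1),
          (8⁻¹ : ENNReal) ^ (n + 1) := by
        refine Finset.sum_le_sum fun T hT => ?_
        have h1 : ∀ r, μ (if r ∈ T then B else Set.univ) ≤
            if r ∈ T then (8⁻¹ : ENNReal) else 1 := by
          intro r; split_ifs
          · exact hμB
          · exact measure_univ.le
        rw [Measure.pi_pi]
        refine (Finset.prod_le_prod' fun r _ => h1 r).trans ?_
        rw [Finset.prod_ite_mem, Finset.univ_inter, Finset.prod_const,
          (Finset.mem_powersetCard.mp hT).2]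
    _ = ((2 * n + 1).choose n : ENNReal) * (8⁻¹ : ENNReal) ^ (n + 1) := by
        rw [Finset.sum_const, Finset.card_powersetCard, Finset.card_univ, Fintype.card_fin,
          nsmul_eq_mul, Nat.choose_symm_half]
    _ ≤ (4 : ENNReal) ^ n * (8⁻¹ : ENNReal) ^ (n + 1) := by
        -- The two middle binomial coefficients of row `2 n + 1` agree and sum to at most `2 ^ R`.
        gcongr
        exact_mod_cast Nat.choose_middle_le_pow n
    _ = ENNReal.ofReal ((4 : ℝ) ^ n * (8⁻¹) ^ (n + 1)) := by
        rw [ENNReal.ofReal_mul (by positivity), ENNReal.ofReal_pow (by norm_num),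
          ENNReal.ofReal_pow (by norm_num), ENNReal.ofReal_inv_of_pos (by norm_num)]
        norm_num
    _ ≤ _ := ENNReal.ofReal_le_ofReal hpow

/-! ### Medians -/

/-- The median lies in every interval that contains a majority of the values. -/
theorem realMedian_mem_Icc {R : ℕ} [NeZero R] {v : Fin R → ℝ} {a b : ℝ} {T : Finset (Fin R)}
    (hT : R < 2 * T.card) (h : ∀ r ∈ T, v r ∈ Set.Icc a b) : realMedian v ∈ Set.Icc a b := by
  set i₀ : Fin R := ⟨R / 2, Nat.div_lt_self (NeZero.pos R) one_lt_two⟩ with hi₀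
  have hmono : Monotone fun i => v (Tuple.sort v i) := Tuple.monotone_sort v
  change v (Tuple.sort v i₀) ∈ Set.Icc a b
  constructor
  · by_contra hlt
    rw [not_le] at hlt
    have hsub : T ⊆ (Finset.Ioi i₀).map (Tuple.sort v).toEmbedding := fun r hr => by
      refine Finset.mem_map.mpr ⟨(Tuple.sort v).symm r, Finset.mem_Ioi.mpr ?_, by simp⟩
      by_contra hle
      have h1 := hmono (not_lt.mp hle)
      simp only [Equiv.apply_symm_apply] at h1
      linarith [(h r hr).1]
    have hcard := Finset.card_le_card hsub
    rw [Finset.card_map, Fin.card_Ioi] at hcard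
    simp only [hi₀] at hcard
    omega
  · by_contra hlt
    rw [not_le] at hlt
    have hsub : T ⊆ (Finset.Iio i₀).map (Tuple.sort v).toEmbedding := fun r hr => by
      refine Finset.mem_map.mpr ⟨(Tuple.sort v).symm r, Finset.mem_Iio.mpr ?_, by simp⟩
      by_contra hle
      have h1 := hmono (not_lt.mp hle)
      simp only [Equiv.apply_symm_apply] at h1
      linarith [(h r hr).2]
    have hcard := Finset.card_le_card hsub
    rw [Finset.card_map, Fin.card_Iio] at hcard
    simp only [hi₀] at hcard
    omega

theorem sq_norm_complexMedian_sub_le {R : ℕ} [NeZero R] {v : Fin R → ℂ} {a : ℂ} {E : ℝ}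
    {T : Finset (Fin R)} (hT : R < 2 * T.card) (h : ∀ r ∈ T, ‖v r - a‖ ^ 2 ≤ E) :
    ‖complexMedian v - a‖ ^ 2 ≤ 2 * E := by
  have hE : 0 ≤ E := by
    obtain ⟨r, hr⟩ := Finset.card_pos.mp (show 0 < T.card by omega)
    exact (sq_nonneg _).trans (h r hr)
  have h1 : ∀ r ∈ T, ‖v r - a‖ ≤ √E := fun r hr => Real.le_sqrt_of_sq_le (h r hr)
  have hre : (complexMedian v).re ∈ Set.Icc (a.re - √E) (a.re + √E) :=
    realMedian_mem_Icc (v := fun r => (v r).re) hT fun r hr => by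
      have := abs_le.mp ((Complex.abs_re_le_norm _).trans (h1 r hr))
      rw [Complex.sub_re] at this
      constructor <;> linarith
  have him : (complexMedian v).im ∈ Set.Icc (a.im - √E) (a.im + √E) :=
    realMedian_mem_Icc (v := fun r => (v r).im) hT fun r hr => by
      have := abs_le.mp ((Complex.abs_im_le_norm _).trans (h1 r hr))
      rw [Complex.sub_im] at this
      constructor <;> linarith
  have hre' : ((complexMedian v).re - a.re) ^ 2 ≤ E := by
    rw [← Real.sq_sqrt hE]
    exact sq_le_sq' (by linarith [hre.1]) (by linarith [hre.2])
  have him' : ((complexMedian v).im - a.im) ^ 2 ≤ E := by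
    rw [← Real.sq_sqrt hE]
    exact sq_le_sq' (by linarith [him.1]) (by linarith [him.2])
  rw [← Complex.normSq_eq_norm_sq, Complex.normSq_apply, Complex.sub_re, Complex.sub_im]
  linarith

theorem abs_sqrt_realMedian_sub_le {R : ℕ} [NeZero R] {v : Fin R → ℂ} {a : ℂ} {E : ℝ}
    {T : Finset (Fin R)} (hT : R < 2 * T.card) (h : ∀ r ∈ T, ‖v r - a‖ ^ 2 ≤ E) :
    |√(realMedian fun r => ‖v r‖ ^ 2) - ‖a‖| ≤ √E := by
  have h1 : ∀ r ∈ T, |‖v r‖ - ‖a‖| ≤ √E := fun r hr =>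
    (abs_norm_sub_norm_le _ _).trans (Real.le_sqrt_of_sq_le (h r hr))
  have hE := Real.sqrt_nonneg E
  have ha := norm_nonneg a
  have hm := realMedian_mem_Icc (v := fun r => ‖v r‖ ^ 2) (a := (max 0 (‖a‖ - √E)) ^ 2)
    (b := (‖a‖ + √E) ^ 2) hT fun r hr => by
      have := abs_le.mp (h1 r hr)
      refine ⟨pow_le_pow_left₀ (le_max_left _ _) (max_le (norm_nonneg _) ?_) 2,
        pow_le_pow_left₀ (norm_nonneg _) ?_ 2⟩ <;> linarith
  have hlo := Real.le_sqrt_of_sq_le hm.1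
  have hhi := Real.sqrt_le_sqrt hm.2
  rw [Real.sqrt_sq (by linarith)] at hhi
  rw [abs_le]
  constructor <;> linarith [le_max_right 0 (‖a‖ - √E)]

/-! ### The error on the good event -/

/-- Since the hyperbolic cross has at most one frequency per residue class modulo `N`, the masses
aliased by every generating vector add up to at most the total mass. -/
theorem sum_varianceBound_le {d N : ℕ} (hN : 2 ≤ N) {g : UnitAddTorus (Fin d) → ℂ}
    (hg : Continuous g) {T : Finset (Fin d → ℤ)}
    (hT : ∀ h ∈ T, h ∈ hyperbolicCross d ((N : ℝ) / 2)) (hcard : T.card ≤ N) :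
    ∑ h ∈ T, varianceBound g N h ≤
      (2 * (N : ℝ) - 1) / ((N : ℝ) - 1) * ∑' k, ‖mFourierCoeff g k‖ ^ 2 := by
  classical
  have hs := (hasSum_sq_mFourierCoeff_of_continuous hg).summable
  have hs' : ∀ h, Summable fun k => if k ≠ h ∧ ∀ j, (N : ℤ) ∣ k j - h j then
      ‖mFourierCoeff g k‖ ^ 2 else 0 := fun h => by
    refine Summable.of_nonneg_of_le (fun k => ?_) (fun k => ?_) hs
    · split_ifs <;> positivity
    · split_ifs
      · exact le_rfl
      · positivity
  have hcong : ∑ h ∈ T, congruentMass g N h ≤ ∑' k, ‖mFourierCoeff g k‖ ^ 2 := by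
    unfold congruentMass
    rw [← Summable.tsum_finsetSum fun h _ => hs' h]
    refine Summable.tsum_le_tsum (fun k => ?_) (summable_sum fun h _ => hs' h) hs
    rw [← Finset.sum_filter, Finset.sum_const, nsmul_eq_mul]
    refine mul_le_of_le_one_left (sq_nonneg _) ?_
    have : (T.filter fun h => k ≠ h ∧ ∀ j, (N : ℤ) ∣ k j - h j).card ≤ 1 := by
      rw [Finset.card_le_one]
      intro h hh h' hh'
      rw [Finset.mem_filter] at hh hh'
      refine eq_of_mem_hyperbolicCross_of_dvd (by omega) (hT h hh.1) (hT h' hh'.1) fun j => ?_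
      have := dvd_sub (hh.2.2 j) (hh'.2.2 j)
      rwa [sub_sub_sub_cancel_left] at this
    exact_mod_cast this
  have hB : 0 ≤ ∑' k, ‖mFourierCoeff g k‖ ^ 2 := tsum_nonneg fun _ => sq_nonneg _
  have hN1 : (0 : ℝ) < (N : ℝ) - 1 := by
    have : (2 : ℝ) ≤ N := by exact_mod_cast hN
    linarith
  have hTN : (T.card : ℝ) ≤ N := by exact_mod_cast hcard
  unfold varianceBound
  rw [Finset.sum_add_distrib, Finset.sum_const, nsmul_eq_mul]
  calc _ ≤ (N : ℝ) * ((∑' k, ‖mFourierCoeff g k‖ ^ 2) / ((N : ℝ) - 1)) +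
        ∑' k, ‖mFourierCoeff g k‖ ^ 2 :=
        add_le_add (mul_le_mul_of_nonneg_right hTN (div_nonneg hB hN1.le)) hcong
    _ = _ := by field_simp; ring

/-- A majority of the `R` draws estimates the `h`-th coefficient of `f` with squared error at
most `E`. -/
def MajorityGood {d R : ℕ} (f : UnitAddTorus (Fin d) → ℂ) (N : ℕ) (ω : Sample d R)
    (h : Fin d → ℤ) (E : ℝ) : Prop :=
  ∃ T : Finset (Fin R), R < 2 * T.card ∧
    ∀ r ∈ T, ‖latticeCoeff f N (ω r).1 (ω r).2 h - mFourierCoeff f h‖ ^ 2 ≤ E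

/-- Parseval's identity bounds the squared error by the errors of the selected coefficients, the
coefficients in `S` that were not selected, and the coefficients outside `S`. -/
theorem l2DistSq_medianApprox_le {d R : ℕ} [NeZero R] {f : UnitAddTorus (Fin d) → ℂ}
    (hf : Continuous f) (N : ℕ) (ω : Sample d R) (S K : Finset (Fin d → ℤ)) :
    l2DistSq f (medianApprox f N ω K) ≤
      ∑ h ∈ K, ‖medianCoeff f N ω h - mFourierCoeff f h‖ ^ 2 +
        ∑ h ∈ S \ K, ‖mFourierCoeff f h‖ ^ 2 +
        ∑' k, ‖mFourierCoeff (removeModes S f) k‖ ^ 2 := by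
  classical
  have hcont : Continuous (medianApprox f N ω K) := by unfold medianApprox; fun_prop
  have hP : HasSum (fun h => ‖mFourierCoeff (fun x => f x - medianApprox f N ω K x) h‖ ^ 2)
      (l2DistSq f (medianApprox f N ω K)) :=
    hasSum_sq_mFourierCoeff_of_continuous (hf.sub hcont)
  have hcoeff : ∀ h, mFourierCoeff (fun x => f x - medianApprox f N ω K x) h =
      mFourierCoeff f h - if h ∈ K then medianCoeff f N ω h else 0 := fun h => by
    rw [mFourierCoeff_sub hf hcont]
    unfold medianApprox
    rw [mFourierCoeff_trigPoly]
  have hfin : ∀ (T : Finset (Fin d → ℤ)) (F : (Fin d → ℤ) → ℝ),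
      HasSum (fun h => if h ∈ T then F h else 0) (∑ h ∈ T, F h) := fun T F => by
    have := hasSum_sum_of_ne_finset_zero (L := .unconditional _)
      (f := fun h => if h ∈ T then F h else 0) (s := T) fun h hh => if_neg hh
    rwa [Finset.sum_congr rfl fun h hh => if_pos hh] at this
  refine hasSum_le (fun h => ?_) hP (((hfin K _).add (hfin (S \ K) _)).add
    (hasSum_sq_mFourierCoeff_of_continuous (continuous_removeModes S hf)).summable.hasSum)
  rw [hcoeff, mFourierCoeff_removeModes S hf]
  by_cases hK : h ∈ K <;> by_cases hS : h ∈ S <;> simp [hK, hS, norm_sub_rev]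

/-- The frequencies of `S` missing from the selection `K` are matched injectively with selected
frequencies outside `S`, whose median squared moduli are no smaller. So the missing coefficients
are controlled by the coefficients outside `S` and the estimation errors. -/
theorem sum_sdiff_selection_le {d N R : ℕ} [NeZero R] (hN : 2 ≤ N)
    {f : UnitAddTorus (Fin d) → ℂ} (hf : Continuous f) {ω : Sample d R}
    {S K : Finset (Fin d → ℤ)} (hS : ∀ h ∈ S, h ∈ hyperbolicCross d ((N : ℝ) / 2))
    (hScard : S.card ≤ N) (hK : IsSelection f N ω K)
    (hgood : ∀ h ∈ hyperbolicCross d ((N : ℝ) / 2),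
      MajorityGood f N ω h (16 * varianceBound (removeModes S f) N h)) :
    ∑ h ∈ S \ K, ‖mFourierCoeff f h‖ ^ 2 ≤
      (96 * ((2 * (N : ℝ) - 1) / ((N : ℝ) - 1)) + 3) *
        ∑' k, ‖mFourierCoeff (removeModes S f) k‖ ^ 2 := by
  classical
  set g := removeModes S f with hg
  have hgc : Continuous g := continuous_removeModes S hf
  have hle : (S \ K).card ≤ (K \ S).card := by
    have h1 := Finset.card_sdiff_add_card_inter S K
    have h2 := Finset.card_sdiff_add_card_inter K S
    rw [Finset.inter_comm] at h2
    have h3 := hK.card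
    omega
  obtain ⟨K', hK', hcard⟩ := Finset.exists_subset_card_eq hle
  let e : (S \ K : Finset (Fin d → ℤ)) ≃ K' := Finset.equivOfCardEq hcard.symm
  have hE : ∀ h, 0 ≤ 16 * varianceBound g N h := fun h =>
    mul_nonneg (by norm_num) (varianceBound_nonneg (by omega) g h)
  have hpair : ∀ h ∈ S \ K, ∀ h' ∈ K', ‖mFourierCoeff f h‖ ^ 2 ≤
      48 * varianceBound g N h + (48 * varianceBound g N h' + 3 * ‖mFourierCoeff g h'‖ ^ 2) := by
    intro h hh h' hh'
    rw [Finset.mem_sdiff] at hh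
    have hh'K := Finset.mem_sdiff.mp (hK' hh')
    obtain ⟨T, hT, hb⟩ := hgood h (hS h hh.1)
    obtain ⟨T', hT', hb'⟩ := hgood h' (hK.subset h' hh'K.1)
    have h1 := (abs_le.mp (abs_sqrt_realMedian_sub_le hT hb)).1
    have h2 := (abs_le.mp (abs_sqrt_realMedian_sub_le hT' hb')).2
    have h3 : √(realMedian fun r => ‖latticeCoeff f N (ω r).1 (ω r).2 h‖ ^ 2) ≤
        √(realMedian fun r => ‖latticeCoeff f N (ω r).1 (ω r).2 h'‖ ^ 2) :=
      Real.sqrt_le_sqrt (hK.largest h' hh'K.1 h (hS h hh.1) hh.2)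
    have h4 : mFourierCoeff g h' = mFourierCoeff f h' := by
      rw [mFourierCoeff_removeModes S hf, if_neg hh'K.2]
    have h5 := Real.sq_sqrt (hE h)
    have h6 := Real.sq_sqrt (hE h')
    rw [h4]
    set x := √(16 * varianceBound g N h)
    set y := √(16 * varianceBound g N h')
    set w := ‖mFourierCoeff f h'‖
    -- `‖f̂ h‖ ≤ √M h + x ≤ √M h' + x ≤ w + y + x`, with `M` the median squared moduli.
    have h7 : ‖mFourierCoeff f h‖ ≤ x + y + w := by linarith
    have h8 := pow_le_pow_left₀ (norm_nonneg _) h7 2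
    have h9 : (x + y + w) ^ 2 ≤ 3 * x ^ 2 + 3 * y ^ 2 + 3 * w ^ 2 := by
      linarith [sq_nonneg (x - y), sq_nonneg (y - w), sq_nonneg (x - w),
        show (x + y + w) ^ 2 + (x - y) ^ 2 + (y - w) ^ 2 + (x - w) ^ 2 =
          3 * x ^ 2 + 3 * y ^ 2 + 3 * w ^ 2 by ring]
    linarith
  have hsum1 : ∑ h ∈ S \ K, varianceBound g N h ≤ _ :=
    sum_varianceBound_le hN hgc (fun h hh => hS h (Finset.mem_sdiff.mp hh).1)
      ((Finset.card_le_card Finset.sdiff_subset).trans hScard)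
  have hsubK : K' ⊆ K := hK'.trans Finset.sdiff_subset
  have hsum2 : ∑ h ∈ K', varianceBound g N h ≤ _ :=
    sum_varianceBound_le hN hgc (fun h hh => hK.subset h (hsubK hh))
      ((Finset.card_le_card hsubK).trans hK.card.le)
  have hsum3 : ∑ h ∈ K', ‖mFourierCoeff g h‖ ^ 2 ≤ ∑' k, ‖mFourierCoeff g k‖ ^ 2 :=
    (hasSum_sq_mFourierCoeff_of_continuous hgc).summable.sum_le_tsum _ fun _ _ => sq_nonneg _
  calc ∑ h ∈ S \ K, ‖mFourierCoeff f h‖ ^ 2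
      = ∑ x : (S \ K : Finset (Fin d → ℤ)), ‖mFourierCoeff f x‖ ^ 2 :=
        (Finset.sum_coe_sort (S \ K) fun h => ‖mFourierCoeff f h‖ ^ 2).symm
    _ ≤ ∑ x : (S \ K : Finset (Fin d → ℤ)), (48 * varianceBound g N x +
          (48 * varianceBound g N (e x) + 3 * ‖mFourierCoeff g (e x)‖ ^ 2)) :=
        Finset.sum_le_sum fun x _ => hpair x x.2 (e x) (e x).2
    _ = 48 * ∑ h ∈ S \ K, varianceBound g N h +
          (48 * ∑ h ∈ K', varianceBound g N h + 3 * ∑ h ∈ K', ‖mFourierCoeff g h‖ ^ 2) := by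
        rw [Finset.sum_add_distrib,
          e.sum_comp fun y => 48 * varianceBound g N y + 3 * ‖mFourierCoeff g y‖ ^ 2,
          Finset.sum_coe_sort (S \ K) fun h => 48 * varianceBound g N h,
          Finset.sum_coe_sort K' fun h => 48 * varianceBound g N h + 3 * ‖mFourierCoeff g h‖ ^ 2,
          Finset.sum_add_distrib, Finset.mul_sum, Finset.mul_sum, Finset.mul_sum]
    _ ≤ _ := by linarith

theorem l2DistSq_le_of_majorityGood {d N R : ℕ} [NeZero R] (hN : 2 ≤ N)
    {f : UnitAddTorus (Fin d) → ℂ} (hf : Continuous f) {ω : Sample d R}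
    {S K : Finset (Fin d → ℤ)} (hS : ∀ h ∈ S, h ∈ hyperbolicCross d ((N : ℝ) / 2))
    (hScard : S.card ≤ N) (hK : IsSelection f N ω K)
    (hgood : ∀ h ∈ hyperbolicCross d ((N : ℝ) / 2),
      MajorityGood f N ω h (16 * varianceBound (removeModes S f) N h)) :
    l2DistSq f (medianApprox f N ω K) ≤
      (128 * ((2 * (N : ℝ) - 1) / ((N : ℝ) - 1)) + 4) *
        ∑' k, ‖mFourierCoeff (removeModes S f) k‖ ^ 2 := by
  have h1 := l2DistSq_medianApprox_le hf N ω S K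
  have h2 := sum_sdiff_selection_le hN hf hS hScard hK hgood
  have h3 : ∑ h ∈ K, ‖medianCoeff f N ω h - mFourierCoeff f h‖ ^ 2 ≤
      ∑ h ∈ K, 32 * varianceBound (removeModes S f) N h := by
    refine Finset.sum_le_sum fun h hh => ?_
    obtain ⟨T, hT, hb⟩ := hgood h (hK.subset h hh)
    have := sq_norm_complexMedian_sub_le hT hb
    unfold medianCoeff
    linarith
  have h4 := sum_varianceBound_le hN (continuous_removeModes S hf) hK.subset hK.card.le
  rw [← Finset.mul_sum] at h3
  linarith

/-- Outside the weighted cross `A_{d,α,γ}(L)` the Fourier weight is at least `L ^ (2 α)`. -/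
theorem tsum_sq_removeModes_mul_le {d : ℕ} {α : ℝ} {γ : Finset (Fin d) → ℝ}
    (hα : 0 ≤ α) (hγ : IsDownwardClosedWeights γ) {f : UnitAddTorus (Fin d) → ℂ}
    (hf : MemKorobov α γ f) {L : ℝ} {S : Finset (Fin d → ℤ)}
    (hS : (S : Set (Fin d → ℤ)) = weightedCross α γ L) :
    (∑' k, ‖mFourierCoeff (removeModes S f) k‖ ^ 2) * L ^ (2 * α) ≤ korobovNormSq α γ f := by
  classical
  have hs := (hasSum_sq_mFourierCoeff_of_continuous
    (continuous_removeModes S hf.continuous)).summable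
  rw [← tsum_mul_right]
  refine Summable.tsum_le_tsum (fun k => ?_) (hs.mul_right _) hf.summable
  rw [mFourierCoeff_removeModes S hf.continuous]
  split_ifs with hk
  · rw [norm_zero, zero_pow two_ne_zero, zero_mul]
    exact mul_nonneg (sq_nonneg _) (zero_le_one.trans (one_le_fourierWeight hα hγ k))
  · have : L ^ (2 * α) ≤ fourierWeight α γ k := by
      rw [← Finset.mem_coe, hS] at hk
      exact not_lt.mp hk
    gcongr

/-! ### The good event -/

open Classical in
/-- For every frequency of the hyperbolic cross at most half of the draws are bad. -/
def goodEvent {d : ℕ} (f : UnitAddTorus (Fin d) → ℂ) (N R : ℕ) (E : (Fin d → ℤ) → ℝ) :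
    Set (Sample d R) :=
  ⋂ h ∈ (finite_hyperbolicCross d ((N : ℝ) / 2)).toFinset,
    {ω | R < 2 * (Finset.univ.filter fun r => ω r ∈ badDraws f N h (E h)).card}ᶜ

theorem measurableSet_goodEvent {d : ℕ} {f : UnitAddTorus (Fin d) → ℂ} (hf : Continuous f)
    (N R : ℕ) (E : (Fin d → ℤ) → ℝ) : MeasurableSet (goodEvent f N R E) := by
  classical
  exact Finset.measurableSet_biInter _ fun h _ =>
    (measurableSet_majority (measurableSet_badDraws hf N h (E h)) R).compl

/-- Because `R` is odd, not having a bad majority means having a good one. -/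
theorem majorityGood_of_mem_goodEvent {d N R : ℕ} (hR : Odd R) {f : UnitAddTorus (Fin d) → ℂ}
    {E : (Fin d → ℤ) → ℝ} {ω : Sample d R} (hω : ω ∈ goodEvent f N R E) {h : Fin d → ℤ}
    (hh : h ∈ hyperbolicCross d ((N : ℝ) / 2)) : MajorityGood f N ω h (E h) := by
  classical
  have h1 := Set.mem_iInter₂.mp hω h ((Set.Finite.mem_toFinset _).mpr hh)
  rw [Set.mem_compl_iff, Set.mem_ofPred_eq] at h1
  refine ⟨Finset.univ.filter fun r => ω r ∉ badDraws f N h (E h), ?_, fun r hr => ?_⟩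
  · have h2 := Finset.card_filter_add_card_filter_not (s := (Finset.univ : Finset (Fin R)))
      (fun r => ω r ∈ badDraws f N h (E h))
    rw [Finset.card_univ, Fintype.card_fin] at h2
    obtain ⟨n, rfl⟩ := hR
    omega
  · exact not_lt.mp (Finset.mem_filter.mp hr).2

theorem sampleLaw_compl_goodEvent_le {d N R : ℕ} (hN : 2 ≤ N) (hR : Odd R)
    {f : UnitAddTorus (Fin d) → ℂ} {E : (Fin d → ℤ) → ℝ}
    (hE : ∀ h ∈ hyperbolicCross d ((N : ℝ) / 2),
      (uniformOn (generatingVectors N d)).prod (torusMeasure d) (badDraws f N h (E h)) ≤ 8⁻¹) :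
    sampleLaw d N R (goodEvent f N R E)ᶜ ≤ ENNReal.ofReal (epsTwo d N R) := by
  classical
  have := isProbabilityMeasure_uniformOn_generatingVectors d hN
  set A := (finite_hyperbolicCross d ((N : ℝ) / 2)).toFinset with hA
  have hcard : (hyperbolicCross d ((N : ℝ) / 2)).ncard = A.card :=
    Set.ncard_eq_toFinset_card _ _
  unfold goodEvent sampleLaw
  simp only [Set.compl_iInter, compl_compl]
  calc _ ≤ ∑ _h ∈ A, ENNReal.ofReal (1 / 2 * (1 / 2 : ℝ) ^ ((R : ℝ) / 2)) :=
        (measure_biUnion_finset_le _ _).trans <| Finset.sum_le_sum fun h hh =>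
          measure_pi_majority_le (hE h ((Set.Finite.mem_toFinset _).mp hh)) hR
    _ = ENNReal.ofReal (A.card * (1 / 2 * (1 / 2 : ℝ) ^ ((R : ℝ) / 2))) := by
        rw [Finset.sum_const, nsmul_eq_mul, ENNReal.ofReal_mul (Nat.cast_nonneg _),
          ENNReal.ofReal_natCast]
    _ ≤ _ := by
        refine ENNReal.ofReal_le_ofReal ?_
        have h1 : (0 : ℝ) ≤ (N : ℝ) / 2 * (3 / 4 : ℝ) ^ ((R : ℝ) / 2) := by positivity
        rw [epsTwo, hcard]
        linarith

end MedianLattice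

theorem mainTheorem1 (d : ℕ) (hd : 1 ≤ d) (α : ℝ) (hα : 1 / 2 < α)
    (γ : Finset (Fin d) → ℝ) (hγ : IsDownwardClosedWeights γ)
    (f : UnitAddTorus (Fin d) → ℂ) (hf : MemKorobov α γ f)
    (N : ℕ) (hN : N.Prime) (hN_odd : Odd N)
    (R : ℕ) [NeZero R] (hR : Odd R)
    (ε : ℝ) (hε : ε ∈ Set.Ioo (0 : ℝ) 1) (hεR : epsOne N R + epsTwo d N R ≤ ε) :
    ∃ G : Set (Sample d R), MeasurableSet G ∧
      ENNReal.ofReal (1 - ε) ≤ sampleLaw d N R G ∧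
      ∀ ω ∈ G, ∀ K : Finset (Fin d → ℤ), IsSelection f N ω K →
        l2DistSq f (medianApprox f N ω K) ≤
          32 * korobovNormSq α γ f * (2 * (N : ℝ) - 1) /
              (nStar α γ N ^ (2 * α) * ((N : ℝ) - 1)) *
            ((991 * (N : ℝ) - 255) / (120 * (2 * (N : ℝ) - 1)) +
              max 960 (Real.sqrt (240 * nStar α γ N ^ (4 * α) * rSumBar α γ N))) := by
  have h2 := hN.two_le
  have hN0 : 0 < N := hN.pos
  have hα0 : 0 < α := by linarith
  have hN2 : (2 : ℝ) ≤ N := by exact_mod_cast h2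
  have hs1 := one_le_nStar hd hα0 hγ hN0
  have hfin := finite_weightedCross hα0 hγ (zero_le_one.trans hs1)
  set S := hfin.toFinset with hS
  have hScoe : (S : Set (Fin d → ℤ)) = weightedCross α γ (nStar α γ N) := hfin.coe_toFinset
  have hScard : (S.card : ℝ) ≤ ((N : ℝ) - 1) / 16 := by
    rw [hS, ← Set.ncard_eq_toFinset_card _ hfin]
    exact ncard_weightedCross_nStar_le hd hα0 hγ hN0
  have hScard' : S.card ≤ N := by
    have : (S.card : ℝ) ≤ N := by linarith
    exact_mod_cast this
  have hSsub : ∀ h ∈ S, h ∈ hyperbolicCross d ((N : ℝ) / 2) := fun h hh =>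
    weightedCross_nStar_subset hd hα0 hγ hN0 (hfin.mem_toFinset.mp hh)
  set E : (Fin d → ℤ) → ℝ := fun h => 16 * varianceBound (removeModes S f) N h with hE
  have hprob := isProbabilityMeasure_uniformOn_generatingVectors d h2
  have hprob' : IsProbabilityMeasure (sampleLaw d N R) := by unfold sampleLaw; infer_instance
  have hmeas := measurableSet_goodEvent hf.continuous N R E
  refine ⟨goodEvent f N R E, hmeas, ?_, fun ω hω K hK => ?_⟩
  · have hbad : sampleLaw d N R (goodEvent f N R E)ᶜ ≤ ENNReal.ofReal (epsTwo d N R) := by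
      refine sampleLaw_compl_goodEvent_le h2 hR fun h hh => ?_
      refine measure_badDraws_le hN hf.continuous hScard fun k hk hkh => ?_
      by_contra hall
      rw [not_exists] at hall
      exact hkh (eq_of_mem_hyperbolicCross_of_dvd hN0 hh (hSsub k hk) fun j =>
        not_not.mp (hall j)).symm
    have h1 : (0 : ℝ) ≤ epsOne N R := by unfold epsOne; positivity
    rw [← compl_compl (goodEvent f N R E), prob_compl_eq_one_sub hmeas.compl,
      ENNReal.ofReal_sub _ hε.1.le, ENNReal.ofReal_one]
    exact tsub_le_tsub_left (hbad.trans (ENNReal.ofReal_le_ofReal (by linarith))) 1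
  · have hmain := l2DistSq_le_of_majorityGood h2 hf.continuous hSsub hScard' hK fun h hh =>
      majorityGood_of_mem_goodEvent hR hω hh
    have hB := tsum_sq_removeModes_mul_le hα0.le hγ hf hScoe
    have hB0 : 0 ≤ ∑' k, ‖mFourierCoeff (removeModes S f) k‖ ^ 2 :=
      tsum_nonneg fun _ => sq_nonneg _
    have hpos : 0 < nStar α γ N ^ (2 * α) := Real.rpow_pos_of_pos (by linarith) _
    have hN1 : 0 < (N : ℝ) - 1 := by linarith
    rw [← le_div_iff₀ hpos] at hB
    have hc : 1 ≤ (2 * (N : ℝ) - 1) / ((N : ℝ) - 1) := by rw [le_div_iff₀ hN1]; linarith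
    have hrat : 0 ≤ (991 * (N : ℝ) - 255) / (120 * (2 * (N : ℝ) - 1)) :=
      div_nonneg (by linarith) (by linarith)
    have hmax := le_max_left 960
      (Real.sqrt (240 * nStar α γ N ^ (4 * α) * rSumBar α γ N))
    set c := (2 * (N : ℝ) - 1) / ((N : ℝ) - 1) with hcdef
    set Q := korobovNormSq α γ f / nStar α γ N ^ (2 * α) with hQ
    have hpre : 32 * korobovNormSq α γ f * (2 * (N : ℝ) - 1) /
        (nStar α γ N ^ (2 * α) * ((N : ℝ) - 1)) = 32 * (c * Q) := by
      rw [hcdef, hQ]; field_simp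
    have hQ0 : 0 ≤ Q := hB0.trans hB
    have hcQ : Q ≤ c * Q := le_mul_of_one_le_left hQ0 hc
    rw [hpre]
    calc l2DistSq f (medianApprox f N ω K)
        ≤ (128 * c + 4) * Q := hmain.trans (mul_le_mul_of_nonneg_left hB (by linarith))
      _ ≤ 32 * (c * Q) * 960 := by linarith
      _ ≤ _ := mul_le_mul_of_nonneg_left (by linarith) (by linarith)
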